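/- Proposition (flower graph upper bound for $\delta$ couplings). Let $\Gamma$ be a compact metric graph with finite vertex set $\mathcal V$, finite edge set $\mathcal E$ (loops and parallel edges allowed) and edge lengths $L(e)\in(0,\infty)$, $e\in\mathcal E$, such that every vertex has positive degree. Each edge $e$ is identified with the interval $[0,L(e)]$. Let $q=(q_e)_{e\in\mathcal E}\in L^\infty(\Gamma)$ be real-valued, let $\alpha_v\in\mathbb R$ for $v\in\mathcal V$, and let $H$ be the Schrödinger operator in $L^2(\Gamma)=\bigoplus_{e} L^2(0,L(e))$ acting by $(Hf)_e=-f_e''+q_ef_e$ on the functions $f\in\bigoplus_e H^2(0,L(e))$ which at each vertex $v$ satisfy the $\delta$ coupling condition of strength $\alpha_v$: all boundary values of $f$ at $v$ coincide with a common value $f(v)$, and the sum, over all edge ends at $v$, of the derivatives of $f$ in the direction pointing from $v$ into the edge equals $\alpha_v f(v)$ (a loop at $v$ has two ends at $v$). Assume that $$\alpha:=\sum_{v\in\mathcal V}\alpha_v>0 .$$ Let $\widehat\Gamma$ be the flower graph with the same edges and edge lengths, i.e. the graph with a single vertex at which every $e\in\mathcal E$ is attached as a loop of length $L(e)$, and let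 $\widehat H$ be the Schrödinger operator in $L^2(\widehat\Gamma)$ with the same potential $q_e$ on each edge and the $\delta$ coupling condition of strength $\alpha$ at the only vertex. Then $H$ and $\widehat H$ have lowest eigenvalues $\lambda_1(H)$ and $\lambda_1(\widehat H)$, and $$\lambda_1(H)\le\lambda_1(\widehat H).$$ Moreover, if $q=0$ almost everywhere, then the equation $$2k\sum_{e\in\mathcal E}\tan\left(\frac{kL(e)}{2}\right)=\alpha$$ has a smallest solution $k$ among the numbers $k\ge 0$ for which all the tangents are defined, and for this $k$ one has $\lambda_1(\widehat H)=k^2$; in particular $\lambda_1(H)\le k^2$. -/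

import Mathlib

open MeasureTheory Set

/-- A compact metric graph: `V` is the finite vertex set, `E` the finite edge set, and the edge `e`
is identified with the interval `[0, length e]`, where `0` corresponds to the vertex `origin e` and
`length e` to the vertex `terminus e`. Loops, parallel edges and disconnected graphs are allowed. -/
structure MetricGraph (V E : Type*) where
  origin : E → V
  terminus : E → V
  length : E → ℝ
  length_pos : ∀ e, 0 < length e

/-- Lebesgue measure on the interval `(0, ℓ)`. -/
noncomputable abbrev edgeMeasure (ℓ : ℝ) : Measure ℝ := volume.restrict (Ioc 0 ℓ)

/-- `u` is absolutely continuous on `[0, ℓ]` with almost everywhere derivative `v ∈ L¹(0, ℓ)`. -/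
def IsPrimitiveOn (ℓ : ℝ) (u v : ℝ → ℂ) : Prop :=
  IntervalIntegrable v volume 0 ℓ ∧ ∀ x ∈ Icc 0 ℓ, u x = u 0 + ∫ s in (0 : ℝ)..x, v s

/-- `u` is (the continuously differentiable representative of) a function in the Sobolev space
`H²(0, ℓ)`, `u₁` is the continuous representative of its derivative on `[0, ℓ]`, and `u₂ ∈ L²(0, ℓ)`
is its second weak derivative. -/
structure IsSobolevTwo (ℓ : ℝ) (u u₁ u₂ : ℝ → ℂ) : Prop where
  primitive : IsPrimitiveOn ℓ u u₁
  primitive_deriv : IsPrimitiveOn ℓ u₁ u₂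
  memLp : MemLp u₂ 2 (edgeMeasure ℓ)

theorem IsPrimitiveOn.add {ℓ : ℝ} {u v u' v' : ℝ → ℂ} (h : IsPrimitiveOn ℓ u v)
    (h' : IsPrimitiveOn ℓ u' v') :
    IsPrimitiveOn ℓ (fun x => u x + u' x) (fun x => v x + v' x) := by
  refine ⟨h.1.add h'.1, fun x hx => ?_⟩
  have hs : uIcc (0 : ℝ) x ⊆ uIcc 0 ℓ := by
    rw [uIcc_of_le hx.1, uIcc_of_le (hx.1.trans hx.2)]
    exact Icc_subset_Icc le_rfl hx.2
  beta_reduce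
  rw [intervalIntegral.integral_add (h.1.mono_set hs) (h'.1.mono_set hs), h.2 x hx, h'.2 x hx]
  ring

theorem IsPrimitiveOn.const_mul {ℓ : ℝ} {u v : ℝ → ℂ} (c : ℂ) (h : IsPrimitiveOn ℓ u v) :
    IsPrimitiveOn ℓ (fun x => c * u x) (fun x => c * v x) := by
  refine ⟨h.1.const_mul c, fun x hx => ?_⟩
  beta_reduce
  rw [intervalIntegral.integral_const_mul, h.2 x hx]
  ring

theorem IsPrimitiveOn.continuousOn {ℓ : ℝ} {u v : ℝ → ℂ} (h : IsPrimitiveOn ℓ u v) :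
    ContinuousOn u (Icc 0 ℓ) := by
  by_cases hℓ : 0 ≤ ℓ
  · have h1 := h.1
    rw [intervalIntegrable_iff_integrableOn_Icc_of_le hℓ] at h1
    have h2 := intervalIntegral.continuousOn_primitive_interval (μ := volume) (f := v) (a := 0)
      (b := ℓ) (by rwa [uIcc_of_le hℓ])
    rw [uIcc_of_le hℓ] at h2
    exact (continuousOn_const.add h2).congr h.2
  · rw [Icc_eq_empty hℓ]
    exact continuousOn_empty u

theorem IsPrimitiveOn.eqOn_zero {ℓ : ℝ} (hℓ : 0 < ℓ) {u v : ℝ → ℂ} (h : IsPrimitiveOn ℓ u v)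
    (h0 : u =ᵐ[edgeMeasure ℓ] 0) : EqOn u 0 (Icc 0 ℓ) := by
  have h1 : u =ᵐ[volume.restrict (Icc 0 ℓ)] 0 := by
    rwa [← Measure.restrict_congr_set (Ioc_ae_eq_Icc (a := (0 : ℝ)) (b := ℓ))]
  exact Measure.eqOn_Icc_of_ae_eq volume hℓ.ne h1 h.continuousOn continuousOn_const

theorem IsPrimitiveOn.deriv_ae_zero {ℓ : ℝ} (hℓ : 0 < ℓ) {u v : ℝ → ℂ} (h : IsPrimitiveOn ℓ u v)
    (h0 : EqOn u 0 (Icc 0 ℓ)) : v =ᵐ[edgeMeasure ℓ] 0 := by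
  have hI : ∀ x ∈ Icc 0 ℓ, ∫ s in (0 : ℝ)..x, v s = 0 := fun x hx => by
    have := h.2 x hx
    rw [h0 hx, h0 ⟨le_rfl, hℓ.le⟩] at this
    simpa using this.symm
  have key := h.1.ae_hasDerivAt_integral
  have h2 : v =ᵐ[volume.restrict (Ioo 0 ℓ)] 0 := by
    rw [Filter.EventuallyEq, ae_restrict_iff' measurableSet_Ioo]
    filter_upwards [key] with x hx hxI
    have hd := hx (by rw [uIcc_of_le hℓ.le]; exact Ioo_subset_Icc_self hxI) 0
      (by rw [uIcc_of_le hℓ.le]; exact ⟨le_rfl, hℓ.le⟩)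
    have hz : (fun y => ∫ s in (0 : ℝ)..y, v s) =ᶠ[nhds x] fun _ => 0 := by
      filter_upwards [Ioo_mem_nhds hxI.1 hxI.2] with y hy
      exact hI y (Ioo_subset_Icc_self hy)
    exact hd.unique ((hasDerivAt_const x (0 : ℂ)).congr_of_eventuallyEq hz)
  rwa [Measure.restrict_congr_set (Ioo_ae_eq_Ioc (a := (0 : ℝ)) (b := ℓ))] at h2

namespace MetricGraph

variable {V E : Type*}

/-- Every vertex is an endpoint of at least one edge, i.e. has positive degree. -/
def NoIsolatedVertex (Γ : MetricGraph V E) : Prop :=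
  ∀ v, ∃ e, Γ.origin e = v ∨ Γ.terminus e = v

/-- The flower graph with the same edges and edge lengths as `Γ`: a single vertex, and every edge
is a loop at it. -/
def flower (Γ : MetricGraph V E) : MetricGraph Unit E where
  origin _ := ()
  terminus _ := ()
  length := Γ.length
  length_pos := Γ.length_pos

/-- The complex Hilbert space `L²(Γ) = ⨁ₑ L²(0, length e)`. -/
abbrev L2 (Γ : MetricGraph V E) : Type _ :=
  PiLp 2 (fun e : E => Lp ℂ 2 (edgeMeasure (Γ.length e)))

/-- The `δ` coupling condition with strength `α v` at every vertex `v`, for a function `u` on `Γ`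
with edgewise derivative `u₁`: the boundary values of `u` at `v` have a common value `c v`, and the
sum over all edge ends at `v` of the derivatives pointing from `v` into the edge is `α v * c v`.
A loop at `v` has two ends at `v`, and contributes to both sums. -/
def DeltaCondition [Fintype E] [DecidableEq V] (Γ : MetricGraph V E) (α : V → ℝ)
    (u u₁ : E → ℝ → ℂ) : Prop :=
  ∃ c : V → ℂ,
    (∀ e, u e 0 = c (Γ.origin e) ∧ u e (Γ.length e) = c (Γ.terminus e)) ∧
    ∀ v, (∑ e with Γ.origin e = v, u₁ e 0) - (∑ e with Γ.terminus e = v, u₁ e (Γ.length e))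
      = (α v : ℂ) * c v

/-- The graph of the Schrödinger operator `H` with potential `q` and `δ` coupling conditions of
strengths `α`: all pairs `(f, g)` where `f` belongs to `H²` on every edge and satisfies the vertex
conditions, and `g = -f'' + q f` on every edge. -/
def schrodingerGraph [Fintype E] [DecidableEq V] (Γ : MetricGraph V E) (q : E → ℝ → ℝ)
    (α : V → ℝ) : Submodule ℂ (Γ.L2 × Γ.L2) where
  carrier := {p | ∃ u u₁ u₂ : E → ℝ → ℂ,
    (∀ e, IsSobolevTwo (Γ.length e) (u e) (u₁ e) (u₂ e)) ∧
    Γ.DeltaCondition α u u₁ ∧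
    (∀ e, p.1 e =ᵐ[edgeMeasure (Γ.length e)] u e) ∧
    ∀ e, p.2 e =ᵐ[edgeMeasure (Γ.length e)] fun x => -u₂ e x + (q e x : ℂ) * u e x}
  zero_mem' := by
    refine ⟨fun _ _ => 0, fun _ _ => 0, fun _ _ => 0, fun e => ⟨⟨?_, ?_⟩, ⟨?_, ?_⟩, ?_⟩,
      ⟨fun _ => 0, ?_, ?_⟩, fun e => ?_, fun e => ?_⟩
    · exact intervalIntegrable_const
    · simp
    · exact intervalIntegrable_const
    · simp
    · exact MemLp.zero'
    · simp
    · simp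
    · exact Lp.coeFn_zero ℂ 2 (edgeMeasure (Γ.length e))
    · filter_upwards [Lp.coeFn_zero ℂ 2 (edgeMeasure (Γ.length e))] with x hx
      rw [neg_zero, mul_zero, add_zero]
      exact hx
  add_mem' := by
    rintro ⟨f, g⟩ ⟨f', g'⟩ ⟨u, u₁, u₂, hu, ⟨c, hc, hk⟩, hf, hg⟩
      ⟨w, w₁, w₂, hw, ⟨d, hd, hl⟩, hf', hg'⟩
    refine ⟨fun e x => u e x + w e x, fun e x => u₁ e x + w₁ e x, fun e x => u₂ e x + w₂ e x,
      fun e => ⟨(hu e).1.add (hw e).1, (hu e).2.add (hw e).2, (hu e).3.add (hw e).3⟩,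
      ⟨fun v => c v + d v, fun e => ⟨?_, ?_⟩, fun v => ?_⟩, fun e => ?_, fun e => ?_⟩
    · simp only [(hc e).1, (hd e).1]
    · simp only [(hc e).2, (hd e).2]
    · rw [Finset.sum_add_distrib, Finset.sum_add_distrib, mul_add, ← hk v, ← hl v]
      ring
    · filter_upwards [Lp.coeFn_add (f e) (f' e), hf e, hf' e] with x h1 h2 h3
      rw [← h2, ← h3]
      exact h1
    · filter_upwards [Lp.coeFn_add (g e) (g' e), hg e, hg' e] with x h1 h2 h3
      refine h1.trans ?_
      rw [Pi.add_apply, h2, h3]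
      ring
  smul_mem' := by
    rintro a ⟨f, g⟩ ⟨u, u₁, u₂, hu, ⟨c, hc, hk⟩, hf, hg⟩
    refine ⟨fun e x => a * u e x, fun e x => a * u₁ e x, fun e x => a * u₂ e x,
      fun e => ⟨(hu e).1.const_mul a, (hu e).2.const_mul a, (hu e).3.const_mul a⟩,
      ⟨fun v => a * c v, fun e => ⟨?_, ?_⟩, fun v => ?_⟩, fun e => ?_, fun e => ?_⟩
    · simp only [(hc e).1]
    · simp only [(hc e).2]
    · rw [← Finset.mul_sum, ← Finset.mul_sum, ← mul_sub, hk v]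
      ring
    · filter_upwards [Lp.coeFn_smul a (f e), hf e] with x h1 h2
      rw [← h2]
      exact h1
    · filter_upwards [Lp.coeFn_smul a (g e), hg e] with x h1 h2
      refine h1.trans ?_
      rw [Pi.smul_apply, h2, smul_eq_mul]
      ring

theorem schrodingerGraph_functional [Fintype E] [DecidableEq V] (Γ : MetricGraph V E)
    (q : E → ℝ → ℝ) (α : V → ℝ) :
    ∀ p ∈ Γ.schrodingerGraph q α, p.1 = 0 → p.2 = 0 := by
  rintro ⟨f, g⟩ ⟨u, u₁, u₂, hu, -, hf, hg⟩ h0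
  simp only at h0 hf hg
  subst h0
  ext1 e
  have hu0 : u e =ᵐ[edgeMeasure (Γ.length e)] 0 :=
    (hf e).symm.trans (Lp.coeFn_zero ℂ 2 (edgeMeasure (Γ.length e)))
  have hU := (hu e).1.eqOn_zero (Γ.length_pos e) hu0
  have hU1 := (hu e).2.eqOn_zero (Γ.length_pos e) ((hu e).1.deriv_ae_zero (Γ.length_pos e) hU)
  have hU2 := (hu e).2.deriv_ae_zero (Γ.length_pos e) hU1
  refine Lp.ext ?_
  filter_upwards [hg e, hu0, hU2, Lp.coeFn_zero ℂ 2 (edgeMeasure (Γ.length e))] with x h1 h2 h3 h4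
  refine Eq.trans ?_ h4.symm
  simp [h1, h2, h3]

/-- The Schrödinger operator `H` in `L²(Γ)` with potential `q` and a `δ` coupling condition of
strength `α v` at each vertex `v`, as an unbounded linear operator. -/
noncomputable def schrodinger [Fintype E] [DecidableEq V] (Γ : MetricGraph V E) (q : E → ℝ → ℝ)
    (α : V → ℝ) : Γ.L2 →ₗ.[ℂ] Γ.L2 :=
  (Γ.schrodingerGraph q α).toLinearPMap

theorem schrodinger_graph [Fintype E] [DecidableEq V] (Γ : MetricGraph V E) (q : E → ℝ → ℝ)
    (α : V → ℝ) : (Γ.schrodinger q α).graph = Γ.schrodingerGraph q α :=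
  Submodule.toLinearPMap_graph_eq _
    (fun p hp h => Γ.schrodingerGraph_functional q α p hp h)

/-- The set of (automatically real) eigenvalues of the Schrödinger operator `H`. -/
def eigenvalues [Fintype E] [DecidableEq V] (Γ : MetricGraph V E) (q : E → ℝ → ℝ) (α : V → ℝ) :
    Set ℝ :=
  {μ | ∃ f : (Γ.schrodinger q α).domain,
    (f : Γ.L2) ≠ 0 ∧ Γ.schrodinger q α f = (μ : ℂ) • (f : Γ.L2)}

/-- The lowest eigenvalue `λ₁(H)`. -/
noncomputable def lambdaOne [Fintype E] [DecidableEq V] (Γ : MetricGraph V E) (q : E → ℝ → ℝ)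
    (α : V → ℝ) : ℝ :=
  sInf (Γ.eigenvalues q α)

/-- The non-negative solutions `k` of the secular equation `2 k ∑ₑ tan (k length(e) / 2) = a`
(in particular, all the tangents are defined at `k`). -/
def secularSolutions [Fintype E] (Γ : MetricGraph V E) (a : ℝ) : Set ℝ :=
  {k | 0 ≤ k ∧ (∀ e, Real.cos (k * Γ.length e / 2) ≠ 0) ∧
    2 * k * ∑ e, Real.tan (k * Γ.length e / 2) = a}

end MetricGraph

/-! The operator belongs to the quadratic form `∑ₑ ∫ (|u'|² + q|u|²) + ∑ᵥ α v |u(v)|²` on functions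
of finite energy, those continuous at the vertices with edgewise derivative in `L²`. A function of
finite energy on the flower graph is exactly such a function on `Γ` taking the same value `c` at all
vertices. For it the vertex terms on `Γ` add up to `(∑ α v)|c|²`, so mass and energy on the two
graphs agree (`energyForm_of_flower`). The flower ground state is therefore a trial function on `Γ`
with Rayleigh quotient `λ₁(Ĥ)`, and the inequality follows.

Most of the work is the variational principle for an operator defined by `H²` functions and
pointwise vertex conditions. `exists_ground_state` finds a minimiser: finite energy embeds compactly
in `L²`, the potential and vertex terms are compact perturbations of the energy norm, and the
Fredholm alternative shows that the optimal lower bound is attained. The minimiser solves the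
equation weakly, and `mem_schrodingerGraph_of_weak` upgrades it to an eigenfunction by choosing test
functions. Conversely, integration by parts gives every eigenfunction the Rayleigh quotient `μ`
(`exists_energyForm_eq_of_mem_eigenvalues`), so the minimum is the lowest eigenvalue.

For `q = 0`, a solution `k` of the secular equation yields an explicit eigenfunction, a cosine
centred at the midpoint of each edge. Below the first pole of the tangents this cosine is positive,
and Picone's identity bounds the form below by `k²` times the mass. Monotonicity of the secular
function there makes `k` the smallest solution. -/

/-! ### Calculus of absolutely continuous functions. -/

/-- Integrable complex functions have absolutely continuous primitives. -/
theorem IntervalIntegrable.absolutelyContinuousOnInterval_primitive {f : ℝ → ℂ} {a b : ℝ}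
    (h : IntervalIntegrable f volume a b) :
    AbsolutelyContinuousOnInterval (fun x => ∫ s in a..x, f s) a b := by
  have hre : IntervalIntegrable (fun x => (f x).re) volume a b := ⟨h.1.re, h.2.re⟩
  have him : IntervalIntegrable (fun x => (f x).im) volume a b := ⟨h.1.im, h.2.im⟩
  have hc : ∀ c : ℂ, AbsolutelyContinuousOnInterval (fun _ : ℝ => c) a b := fun c =>
    (LipschitzWith.const c).lipschitzOnWith.absolutelyContinuousOnInterval (K := 0)
  -- The real and imaginary parts are treated separately and recombined as `re • 1 + im • I`.
  have h1 := (hre.absolutelyContinuousOnInterval_intervalIntegral left_mem_uIcc).fun_smul (hc 1)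
  have h2 := (him.absolutelyContinuousOnInterval_intervalIntegral left_mem_uIcc).fun_smul
    (hc Complex.I)
  have h3 := h1.add h2
  rw [absolutelyContinuousOnInterval_iff] at h3 ⊢
  intro ε hε
  obtain ⟨δ, hδ, H⟩ := h3 ε hε
  refine ⟨δ, hδ, fun E hE hl => ?_⟩
  have key : ∀ x ∈ uIcc a b, (∫ s in a..x, f s) =
      ((fun x => (∫ s in a..x, (f s).re) • (1 : ℂ)) +
        fun x => (∫ s in a..x, (f s).im) • Complex.I) x := by
    intro x hx
    have hs : uIcc a x ⊆ uIcc a b := uIcc_subset_uIcc left_mem_uIcc hx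
    have hre' : IntervalIntegrable (fun x => ((f x).re : ℂ)) volume a x :=
      ⟨(hre.mono_set hs).1.ofReal, (hre.mono_set hs).2.ofReal⟩
    have him' : IntervalIntegrable (fun x => ((f x).im : ℂ)) volume a x :=
      ⟨(him.mono_set hs).1.ofReal, (him.mono_set hs).2.ofReal⟩
    have hsum := intervalIntegral.integral_add
      (hre'.mul_const (1 : ℂ)) (him'.mul_const Complex.I)
    rw [intervalIntegral.integral_mul_const, intervalIntegral.integral_mul_const,
      intervalIntegral.integral_ofReal, intervalIntegral.integral_ofReal] at hsum
    simp only [Pi.add_apply, Complex.real_smul]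
    rw [← hsum]
    congr 1
    ext s
    simp [Complex.re_add_im]
  have := H E hE hl
  convert this using 3 with i hi
  · exact key _ (hE.1 i hi).1
  · exact key _ (hE.1 i hi).2

/-- The product rule for absolutely continuous functions. -/
theorem IsPrimitiveOn.mul {ℓ : ℝ} (hℓ : 0 ≤ ℓ) {u v u' v' : ℝ → ℂ} (h : IsPrimitiveOn ℓ u u')
    (h' : IsPrimitiveOn ℓ v v') :
    IsPrimitiveOn ℓ (fun x => u x * v x) (fun x => u' x * v x + u x * v' x) := by
  have hcu : ContinuousOn u (uIcc 0 ℓ) := by rw [uIcc_of_le hℓ]; exact h.continuousOn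
  have hcv : ContinuousOn v (uIcc 0 ℓ) := by rw [uIcc_of_le hℓ]; exact h'.continuousOn
  have hi : IntervalIntegrable (fun x => u' x * v x + u x * v' x) volume 0 ℓ :=
    (h.1.mul_continuousOn hcv).add (h'.1.continuousOn_mul hcu)
  refine ⟨hi, fun x hx => ?_⟩
  set U : ℝ → ℂ := fun x => u 0 + ∫ s in (0 : ℝ)..x, u' s
  set W : ℝ → ℂ := fun x => v 0 + ∫ s in (0 : ℝ)..x, v' s
  have hc : ∀ c : ℂ, AbsolutelyContinuousOnInterval (fun _ : ℝ => c) 0 ℓ := fun c =>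
    (LipschitzWith.const c).lipschitzOnWith.absolutelyContinuousOnInterval (K := 0)
  have hU : AbsolutelyContinuousOnInterval U 0 ℓ :=
    (hc (u 0)).add h.1.absolutelyContinuousOnInterval_primitive
  have hW : AbsolutelyContinuousOnInterval W 0 ℓ :=
    (hc (v 0)).add h'.1.absolutelyContinuousOnInterval_primitive
  have hP := (hU.smul hW).sub hi.absolutelyContinuousOnInterval_primitive
  -- The product minus the primitive of its formal derivative is absolutely continuous with
  -- derivative zero almost everywhere, hence constant.
  obtain ⟨C, hC⟩ := hP.const_of_ae_hasDerivAt_zero (by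
    filter_upwards [h.1.ae_hasDerivAt_integral, h'.1.ae_hasDerivAt_integral,
      hi.ae_hasDerivAt_integral] with y h1 h2 h3 hy
    have e1 := (h1 hy 0 left_mem_uIcc).const_add (u 0)
    have e2 := (h2 hy 0 left_mem_uIcc).const_add (v 0)
    have e3 := h3 hy 0 left_mem_uIcc
    have e4 := (e1.mul e2).sub e3
    rw [uIcc_of_le hℓ] at hy
    rw [← h.2 y hy, ← h'.2 y hy, sub_self] at e4
    exact e4)
  have c1 := hC x (by rwa [uIcc_of_le hℓ])
  have c2 := hC 0 left_mem_uIcc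
  rw [← c2] at c1
  simp only [Pi.sub_apply, smul_eq_mul, Pi.mul_apply, intervalIntegral.integral_same, sub_zero,
    U, W, add_zero] at c1
  rw [← h.2 x hx, ← h'.2 x hx] at c1
  beta_reduce
  rw [← c1]
  ring

theorem IsPrimitiveOn.conj {ℓ : ℝ} {u v : ℝ → ℂ} (h : IsPrimitiveOn ℓ u v) :
    IsPrimitiveOn ℓ (fun x => star (u x)) (fun x => star (v x)) := by
  refine ⟨⟨?_, ?_⟩, fun x hx => ?_⟩
  · exact (Complex.conjLIE.toContinuousLinearEquiv.toContinuousLinearMap).integrable_comp h.1.1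
  · exact (Complex.conjLIE.toContinuousLinearEquiv.toContinuousLinearMap).integrable_comp h.1.2
  · beta_reduce
    rw [h.2 x hx, star_add]
    congr 1
    simp only [intervalIntegral]
    rw [star_sub]
    congr 1 <;> exact (integral_conj (𝕜 := ℂ)).symm

/-- Integration by parts for absolutely continuous functions. -/
theorem IsPrimitiveOn.integral_add_eq {ℓ : ℝ} (hℓ : 0 ≤ ℓ) {u v u' v' : ℝ → ℂ}
    (h : IsPrimitiveOn ℓ u u') (h' : IsPrimitiveOn ℓ v v') :
    (∫ x in (0 : ℝ)..ℓ, u' x * v x) + ∫ x in (0 : ℝ)..ℓ, u x * v' x = u ℓ * v ℓ - u 0 * v 0 := by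
  have hcu : ContinuousOn u (uIcc 0 ℓ) := by rw [uIcc_of_le hℓ]; exact h.continuousOn
  have hcv : ContinuousOn v (uIcc 0 ℓ) := by rw [uIcc_of_le hℓ]; exact h'.continuousOn
  rw [← intervalIntegral.integral_add (h.1.mul_continuousOn hcv) (h'.1.continuousOn_mul hcu),
    eq_sub_iff_add_eq'.2 ((h.mul hℓ h').2 ℓ ⟨hℓ, le_rfl⟩).symm]

theorem IsPrimitiveOn.of_hasDerivAt {ℓ : ℝ} (hℓ : 0 ≤ ℓ) {u v : ℝ → ℂ}
    (h : ∀ x ∈ Icc 0 ℓ, HasDerivAt u (v x) x) (hv : ContinuousOn v (Icc 0 ℓ)) :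
    IsPrimitiveOn ℓ u v := by
  have hi : IntervalIntegrable v volume 0 ℓ :=
    ContinuousOn.intervalIntegrable (by rwa [uIcc_of_le hℓ])
  refine ⟨hi, fun x hx => ?_⟩
  have hs : uIcc 0 x ⊆ Icc 0 ℓ := by
    rw [uIcc_of_le hx.1]; exact Icc_subset_Icc le_rfl hx.2
  rw [intervalIntegral.integral_eq_sub_of_hasDerivAt (fun y hy => h y (hs hy))
    (hi.mono_set (by rwa [uIcc_of_le hℓ]))]
  ring

/-! ### Primitives of `L²` functions and their compactness. -/

/-- The function `x ↦ c + ∫₀ˣ g`. -/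
noncomputable def primitiveFrom (c : ℂ) (g : ℝ → ℂ) (x : ℝ) : ℂ := c + ∫ s in (0 : ℝ)..x, g s

theorem primitiveFrom_zero (c : ℂ) (g : ℝ → ℂ) : primitiveFrom c g 0 = c := by
  simp [primitiveFrom]

theorem isPrimitiveOn_primitiveFrom {ℓ : ℝ} (c : ℂ) {g : ℝ → ℂ}
    (hg : IntervalIntegrable g volume 0 ℓ) : IsPrimitiveOn ℓ (primitiveFrom c g) g :=
  ⟨hg, fun x _ => by rw [primitiveFrom_zero, primitiveFrom]⟩

theorem MeasureTheory.MemLp.intervalIntegrable_edge {ℓ : ℝ} (hℓ : 0 ≤ ℓ) {g : ℝ → ℂ}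
    (hg : MemLp g 2 (edgeMeasure ℓ)) : IntervalIntegrable g volume 0 ℓ := by
  rw [intervalIntegrable_iff_integrableOn_Ioc_of_le hℓ]
  exact hg.integrable (by norm_num)

theorem memLp_edge_of_continuousOn {ℓ : ℝ} {u : ℝ → ℂ} (hu : ContinuousOn u (Icc 0 ℓ)) :
    MemLp u 2 (edgeMeasure ℓ) := by
  obtain ⟨C, hC⟩ := isCompact_Icc.exists_bound_of_continuousOn hu
  refine MemLp.of_bound ((hu.mono Ioc_subset_Icc_self).aestronglyMeasurable measurableSet_Ioc) C ?_
  filter_upwards [ae_restrict_mem measurableSet_Ioc] with x hx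
  exact hC x (Ioc_subset_Icc_self hx)

theorem primitiveFrom_congr {ℓ : ℝ} (c : ℂ) {g g' : ℝ → ℂ} (h : g =ᵐ[edgeMeasure ℓ] g') {x : ℝ}
    (hx : x ∈ Icc 0 ℓ) : primitiveFrom c g x = primitiveFrom c g' x := by
  rw [primitiveFrom, primitiveFrom, intervalIntegral.integral_of_le hx.1,
    intervalIntegral.integral_of_le hx.1]
  congr 1
  exact integral_congr_ae (ae_restrict_of_ae_restrict_of_subset (Ioc_subset_Ioc_right hx.2) h)

/-- Cauchy–Schwarz against the indicator of `(x, y]`, whose norm is `√(y - x)`. -/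
theorem norm_intervalIntegral_le_sqrt_mul_norm {ℓ : ℝ} (g : Lp ℂ 2 (edgeMeasure ℓ)) {x y : ℝ}
    (hx : 0 ≤ x) (hxy : x ≤ y) (hy : y ≤ ℓ) :
    ‖∫ s in x..y, g s‖ ≤ Real.sqrt (y - x) * ‖g‖ := by
  have hsub : Ioc x y ⊆ Ioc 0 ℓ := Ioc_subset_Ioc hx hy
  have hm : (edgeMeasure ℓ) (Ioc x y) = ENNReal.ofReal (y - x) := by
    rw [Measure.restrict_apply measurableSet_Ioc, inter_eq_left.2 hsub, Real.volume_Ioc]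
  have hfin : (edgeMeasure ℓ) (Ioc x y) ≠ ⊤ := by rw [hm]; exact ENNReal.ofReal_ne_top
  have h1 := L2.inner_indicatorConstLp_one (𝕜 := ℂ) measurableSet_Ioc hfin g
  rw [Measure.restrict_restrict measurableSet_Ioc, inter_eq_left.2 hsub,
    ← intervalIntegral.integral_of_le hxy] at h1
  rw [← h1]
  refine (norm_inner_le_norm _ _).trans (le_of_eq ?_)
  rw [norm_indicatorConstLp (by norm_num) (by norm_num), Measure.real, hm,
    ENNReal.toReal_ofReal (sub_nonneg.2 hxy), Real.sqrt_eq_rpow]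
  norm_num

theorem intervalIntegrable_edge_coeFn {ℓ : ℝ} (hℓ : 0 ≤ ℓ) (g : Lp ℂ 2 (edgeMeasure ℓ)) :
    IntervalIntegrable g volume 0 ℓ := (Lp.memLp g).intervalIntegrable_edge hℓ

/-- Hölder continuity of exponent 1/2, with a constant depending only on `‖g‖`: the equicontinuity
needed for Arzelà–Ascoli. -/
theorem dist_primitiveFrom_le {ℓ : ℝ} (hℓ : 0 ≤ ℓ) (c : ℂ) (g : Lp ℂ 2 (edgeMeasure ℓ)) {x y : ℝ}
    (hx : x ∈ Icc 0 ℓ) (hy : y ∈ Icc 0 ℓ) :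
    dist (primitiveFrom c g x) (primitiveFrom c g y) ≤ Real.sqrt (dist x y) * ‖g‖ := by
  wlog hxy : x ≤ y generalizing x y
  · rw [dist_comm, dist_comm x y]
    exact this hy hx (le_of_not_ge hxy)
  have hi : ∀ z ∈ Icc 0 ℓ, IntervalIntegrable g volume 0 z := fun z hz =>
    (intervalIntegrable_edge_coeFn hℓ g).mono_set (by
      rw [uIcc_of_le hz.1, uIcc_of_le hℓ]; exact Icc_subset_Icc le_rfl hz.2)
  rw [dist_comm, dist_eq_norm, primitiveFrom, primitiveFrom, add_sub_add_left_eq_sub,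
    intervalIntegral.integral_interval_sub_left (hi y hy) (hi x hx), dist_comm, Real.dist_eq,
    abs_of_nonneg (sub_nonneg.2 hxy)]
  exact norm_intervalIntegral_le_sqrt_mul_norm g hx.1 hxy hy.2

theorem primitiveFrom_add {ℓ : ℝ} (hℓ : 0 ≤ ℓ) (c c' : ℂ) (g g' : Lp ℂ 2 (edgeMeasure ℓ)) {x : ℝ}
    (hx : x ∈ Icc 0 ℓ) : primitiveFrom (c + c') (g + g' : Lp ℂ 2 (edgeMeasure ℓ)) x =
      primitiveFrom c g x + primitiveFrom c' g' x := by
  have hs : uIcc 0 x ⊆ uIcc 0 ℓ := by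
    rw [uIcc_of_le hx.1, uIcc_of_le hℓ]; exact Icc_subset_Icc le_rfl hx.2
  rw [primitiveFrom_congr _ (Lp.coeFn_add g g') hx]
  simp only [primitiveFrom, Pi.add_apply]
  rw [intervalIntegral.integral_add ((intervalIntegrable_edge_coeFn hℓ g).mono_set hs)
    ((intervalIntegrable_edge_coeFn hℓ g').mono_set hs)]
  ring

theorem primitiveFrom_smul {ℓ : ℝ} (a c : ℂ) (g : Lp ℂ 2 (edgeMeasure ℓ)) {x : ℝ}
    (hx : x ∈ Icc 0 ℓ) : primitiveFrom (a * c) (a • g : Lp ℂ 2 (edgeMeasure ℓ)) x =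
      a * primitiveFrom c g x := by
  rw [primitiveFrom_congr _ (Lp.coeFn_smul a g) hx]
  simp only [primitiveFrom, Pi.smul_apply, smul_eq_mul, intervalIntegral.integral_const_mul]
  ring

open BoundedContinuousFunction in
/-- The Volterra operator `g ↦ (x ↦ ∫₀ˣ g)` as an operator from `L²` to the continuous functions. -/
noncomputable def volterraCont {ℓ : ℝ} (hℓ : 0 < ℓ) :
    Lp ℂ 2 (edgeMeasure ℓ) →L[ℂ] (Icc 0 ℓ →ᵇ ℂ) :=
  LinearMap.mkContinuous
    { toFun := fun g => mkOfCompact ⟨fun x => primitiveFrom 0 g x,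
        continuousOn_iff_continuous_domRestrict.1
          (isPrimitiveOn_primitiveFrom 0 (intervalIntegrable_edge_coeFn hℓ.le g)).continuousOn⟩
      map_add' := fun g g' => by
        ext x
        have := primitiveFrom_add hℓ.le 0 0 g g' x.2
        rw [add_zero] at this
        exact this
      map_smul' := fun a g => by
        ext x
        have := primitiveFrom_smul a 0 g x.2
        rw [mul_zero] at this
        exact this } (Real.sqrt ℓ) (fun g => by
    rw [norm_le (by positivity)]
    intro x
    have h0 : (0 : ℝ) ∈ Icc 0 ℓ := ⟨le_rfl, hℓ.le⟩
    have := dist_primitiveFrom_le hℓ.le 0 g x.2 h0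
    rw [primitiveFrom_zero, dist_zero_right, dist_zero_right, Real.norm_eq_abs,
      abs_of_nonneg x.2.1] at this
    exact this.trans (by gcongr; exact x.2.2))

theorem volterraCont_apply {ℓ : ℝ} (hℓ : 0 < ℓ) (g : Lp ℂ 2 (edgeMeasure ℓ)) (x : Icc 0 ℓ) :
    volterraCont hℓ g x = ∫ s in (0 : ℝ)..x, g s := by
  change primitiveFrom 0 g x = _
  rw [primitiveFrom, zero_add]

/-- By Arzelà–Ascoli: the image of the unit ball is bounded by `√ℓ` and has `√` as a common modulus
of continuity. -/
theorem isCompactOperator_volterraCont {ℓ : ℝ} (hℓ : 0 < ℓ) :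
    IsCompactOperator (volterraCont hℓ) := by
  have : ((volterraCont hℓ : _ →L[ℂ] _) : Lp ℂ 2 (edgeMeasure ℓ) → _) =
    ((volterraCont hℓ : _ →L[ℂ] _) : Lp ℂ 2 (edgeMeasure ℓ) →ₗ[ℂ] _) := rfl
  rw [this, isCompactOperator_iff_isCompact_closure_image_closedBall (𝕜₁ := ℂ) _ one_pos]
  refine BoundedContinuousFunction.arzela_ascoli (Metric.closedBall 0 (Real.sqrt ℓ))
    (isCompact_closedBall _ _) _ ?_ ?_
  · rintro _ x ⟨g, hg, rfl⟩
    rw [mem_closedBall_zero_iff] at hg ⊢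
    refine (BoundedContinuousFunction.norm_coe_le_norm _ x).trans ?_
    have := (volterraCont hℓ).le_of_opNorm_le
      (LinearMap.mkContinuous_norm_le _ (Real.sqrt_nonneg ℓ) _) g
    exact this.trans (mul_le_of_le_one_right (Real.sqrt_nonneg ℓ) hg)
  · refine Metric.equicontinuous_of_continuity_modulus Real.sqrt ?_ _ ?_
    · simpa using Real.continuous_sqrt.tendsto 0
    · rintro x y ⟨_, g, hg, rfl⟩
      rw [mem_closedBall_zero_iff] at hg
      exact (dist_primitiveFrom_le hℓ.le 0 g x.2 y.2).trans
        (mul_le_of_le_one_right (Real.sqrt_nonneg _) hg)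

open BoundedContinuousFunction in
/-- The inclusion of the continuous functions on `[0, ℓ]` into `L²(0, ℓ)`. -/
noncomputable def contToEdgeLp {ℓ : ℝ} (hℓ : 0 < ℓ) :
    (Icc 0 ℓ →ᵇ ℂ) →L[ℂ] Lp ℂ 2 (edgeMeasure ℓ) :=
  LinearMap.mkContinuous
    { toFun := fun f => (memLp_edge_of_continuousOn
        ((f.continuous.Icc_extend' (h := hℓ.le)).continuousOn)).toLp (IccExtend hℓ.le f)
      map_add' := fun _ _ => rfl
      map_smul' := fun _ _ => rfl } _ (fun f =>
    (Lp.norm_le_of_ae_bound (norm_nonneg f) (by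
      filter_upwards [MemLp.coeFn_toLp (memLp_edge_of_continuousOn
        ((f.continuous.Icc_extend' (h := hℓ.le)).continuousOn))] with x hx
      refine (congrArg _ hx).trans_le ?_
      exact f.norm_coe_le_norm _)))

theorem coeFn_contToEdgeLp {ℓ : ℝ} (hℓ : 0 < ℓ) (f : BoundedContinuousFunction (Icc 0 ℓ) ℂ) :
    contToEdgeLp hℓ f =ᵐ[edgeMeasure ℓ] IccExtend hℓ.le f :=
  MemLp.coeFn_toLp (memLp_edge_of_continuousOn
    ((f.continuous.Icc_extend' (h := hℓ.le)).continuousOn))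

/-- The operator `(c, g) ↦ (x ↦ c + ∫₀ˣ g)` in `L²(0, ℓ)`. -/
noncomputable def primitiveL {ℓ : ℝ} (hℓ : 0 < ℓ) :
    ℂ × Lp ℂ 2 (edgeMeasure ℓ) →L[ℂ] Lp ℂ 2 (edgeMeasure ℓ) :=
  contToEdgeLp hℓ ∘L
    ((ContinuousLinearMap.toSpanSingleton ℂ (BoundedContinuousFunction.const (Icc 0 ℓ) (1 : ℂ))) ∘L
      ContinuousLinearMap.fst ℂ ℂ _ + volterraCont hℓ ∘L ContinuousLinearMap.snd ℂ ℂ _)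

theorem coeFn_primitiveL {ℓ : ℝ} (hℓ : 0 < ℓ) (p : ℂ × Lp ℂ 2 (edgeMeasure ℓ)) :
    primitiveL hℓ p =ᵐ[edgeMeasure ℓ] primitiveFrom p.1 p.2 := by
  filter_upwards [coeFn_contToEdgeLp hℓ
    (p.1 • BoundedContinuousFunction.const (Icc 0 ℓ) (1 : ℂ) + volterraCont hℓ p.2),
    ae_restrict_mem measurableSet_Ioc] with x hx hx'
  refine hx.trans ?_
  rw [IccExtend_of_mem hℓ.le _ (Ioc_subset_Icc_self hx')]
  simp [volterraCont_apply, primitiveFrom]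

/-- The constant term factors through `ℂ`, the integral term through the compact Volterra operator.
-/
theorem isCompactOperator_primitiveL {ℓ : ℝ} (hℓ : 0 < ℓ) : IsCompactOperator (primitiveL hℓ) := by
  refine IsCompactOperator.clm_comp (f := ⇑((ContinuousLinearMap.toSpanSingleton ℂ
    (BoundedContinuousFunction.const (Icc 0 ℓ) (1 : ℂ))) ∘L
      ContinuousLinearMap.fst ℂ ℂ (Lp ℂ 2 (edgeMeasure ℓ)) +
      volterraCont hℓ ∘L ContinuousLinearMap.snd ℂ ℂ _)) ?_ (contToEdgeLp hℓ)
  have h1 : IsCompactOperator (⇑(ContinuousLinearMap.toSpanSingleton ℂ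
      (BoundedContinuousFunction.const (Icc 0 ℓ) (1 : ℂ))) ∘
      ⇑(ContinuousLinearMap.fst ℂ ℂ (Lp ℂ 2 (edgeMeasure ℓ)))) :=
    (isCompactOperator_of_locallyCompactSpace_dom _).clm_comp _
  have h2 : IsCompactOperator (⇑(volterraCont hℓ) ∘
      ⇑(ContinuousLinearMap.snd ℂ ℂ (Lp ℂ 2 (edgeMeasure ℓ)))) :=
    (isCompactOperator_volterraCont hℓ).comp_clm _
  exact h1.add h2

/-! ### Minimisation of a compactly perturbed quadratic form. -/

section GroundState

variable {D L : Type*} [NormedAddCommGroup D] [InnerProductSpace ℂ D]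
  [NormedAddCommGroup L] [InnerProductSpace ℂ L]

/-- A bounded positive operator `A` satisfies `‖A x‖² ≤ (‖A‖ + 1) ⟪A x, x⟫`. -/
theorem norm_sq_le_of_re_inner_nonneg (A : D →L[ℂ] D) (hA : (A : D →ₗ[ℂ] D).IsSymmetric)
    (hpos : ∀ x, 0 ≤ (inner ℂ (A x) x).re) (x : D) :
    ‖A x‖ ^ 2 ≤ (‖A‖ + 1) * (inner ℂ (A x) x).re := by
  set M := ‖A‖ + 1
  have hM : 0 < M := by positivity
  -- Expanding positivity at `M x - A x` gives `-2M‖A x‖²` and a last term of at most `M‖A x‖²`;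
  -- dividing by `M` leaves the claim. The `+ 1` in `M` allows the division.
  have h1 := hpos ((M : ℂ) • x - A x)
  have e1 : (inner ℂ (A ((M : ℂ) • x - A x)) ((M : ℂ) • x - A x)).re =
      M ^ 2 * (inner ℂ (A x) x).re - 2 * M * ‖A x‖ ^ 2 + (inner ℂ (A (A x)) (A x)).re := by
    have e2 : inner ℂ (A (A x)) x = inner ℂ (A x) (A x) := hA (A x) x
    simp only [map_sub, map_smul, inner_sub_left, inner_sub_right, inner_smul_left,
      inner_smul_right, e2, inner_self_eq_norm_sq_to_K, Complex.conj_ofReal]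
    simp [← Complex.ofReal_pow]
    ring
  have e3 : (inner ℂ (A (A x)) (A x)).re ≤ M * ‖A x‖ ^ 2 := by
    calc (inner ℂ (A (A x)) (A x)).re ≤ ‖A (A x)‖ * ‖A x‖ := re_inner_le_norm (𝕜 := ℂ) _ _
      _ ≤ (‖A‖ * ‖A x‖) * ‖A x‖ := by gcongr; exact A.le_opNorm _
      _ ≤ M * ‖A x‖ ^ 2 := by nlinarith [sq_nonneg ‖A x‖]
  rw [e1] at h1
  have h2 : 0 ≤ M * (M * (inner ℂ (A x) x).re - ‖A x‖ ^ 2) := by linarith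
  linarith [nonneg_of_mul_nonneg_right h2 hM]

variable [CompleteSpace D] [CompleteSpace L]

/-- If `T` is injective then every continuous functional on `D` is, up to a small error, bounded
by `‖T x‖`. -/
theorem exists_norm_inner_le_of_injective (T : D →L[ℂ] L) (hT : Function.Injective T) (φ : D)
    {ε : ℝ} (hε : 0 < ε) : ∃ C : ℝ, ∀ x, ‖inner ℂ φ x‖ ≤ ε * ‖x‖ + C * ‖T x‖ := by
  have h := T.orthogonal_ker
  rw [LinearMap.ker_eq_bot.2 hT, Submodule.bot_orthogonal_eq_top] at h
  -- Injectivity of `T` makes the range of its adjoint dense, so `φ` is within `ε` of some `T* ψ`,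
  -- and `⟪T* ψ, x⟫ = ⟪ψ, T x⟫`.
  have hφ : φ ∈ (ContinuousLinearMap.adjoint T).range.topologicalClosure := by
    rw [← h]; trivial
  obtain ⟨_, ⟨ψ, rfl⟩, hψ⟩ := Metric.mem_closure_iff.1 hφ ε hε
  refine ⟨‖ψ‖, fun x => ?_⟩
  have e : inner ℂ φ x = inner ℂ (φ - ContinuousLinearMap.adjoint T ψ) x + inner ℂ ψ (T x) := by
    rw [inner_sub_left, ContinuousLinearMap.adjoint_inner_left]; ring
  rw [e]
  refine (norm_add_le _ _).trans (add_le_add ?_ (norm_inner_le_norm _ _))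
  refine (norm_inner_le_norm _ _).trans ?_
  gcongr
  rw [← dist_eq_norm]
  exact hψ.le

/-- If `T` is injective then finitely many continuous functionals perturb the squared norm of `D`
only by a multiple of `‖T x‖²` from below. -/
theorem exists_mul_norm_sq_le_add_sum {ι : Type*} [Fintype ι] (T : D →L[ℂ] L)
    (hT : Function.Injective T) (φ : ι → D →L[ℂ] ℂ) (β : ι → ℝ) :
    ∃ C : ℝ, ∀ x, C * ‖T x‖ ^ 2 ≤ ‖x‖ ^ 2 + ∑ i, β i * ‖φ i x‖ ^ 2 := by
  set S := ∑ i, |β i|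
  have hS : 0 ≤ S := Finset.sum_nonneg fun i _ => abs_nonneg _
  -- With this `ε`, `2 S ε² ≤ 1`, so the error terms are absorbed by `‖x‖²`.
  have hε : 0 < 1 / (2 * (S + 1)) := by positivity
  choose C hC using fun i =>
    exists_norm_inner_le_of_injective T hT ((InnerProductSpace.toDual ℂ D).symm (φ i)) hε
  simp only [InnerProductSpace.toDual_symm_apply] at hC
  refine ⟨-(2 * ∑ i, |β i| * C i ^ 2), fun x => ?_⟩
  have h1 : ∀ i, -(|β i| * (2 * (1 / (2 * (S + 1))) ^ 2 * ‖x‖ ^ 2 + 2 * C i ^ 2 * ‖T x‖ ^ 2)) ≤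
      β i * ‖φ i x‖ ^ 2 := by
    intro i
    have h2 : ‖φ i x‖ ^ 2 ≤ 2 * (1 / (2 * (S + 1))) ^ 2 * ‖x‖ ^ 2 + 2 * C i ^ 2 * ‖T x‖ ^ 2 := by
      have h3 : ‖φ i x‖ ^ 2 ≤ (1 / (2 * (S + 1)) * ‖x‖ + C i * ‖T x‖) ^ 2 := by
        gcongr; exact hC i x
      nlinarith [sq_nonneg (1 / (2 * (S + 1)) * ‖x‖ - C i * ‖T x‖)]
    have h4 := mul_le_mul_of_nonneg_left h2 (abs_nonneg (β i))
    have h5 : -(|β i| * ‖φ i x‖ ^ 2) ≤ β i * ‖φ i x‖ ^ 2 := by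
      rw [← neg_mul]
      gcongr
      exact neg_abs_le _
    linarith
  have h2 := Finset.sum_le_sum fun i (_ : i ∈ Finset.univ) => h1 i
  have h3 : ∑ i, -(|β i| * (2 * (1 / (2 * (S + 1))) ^ 2 * ‖x‖ ^ 2 + 2 * C i ^ 2 * ‖T x‖ ^ 2)) =
      -(S * (2 * (1 / (2 * (S + 1))) ^ 2 * ‖x‖ ^ 2)) -
        (2 * ∑ i, |β i| * C i ^ 2) * ‖T x‖ ^ 2 := by
    rw [Finset.sum_neg_distrib, Finset.sum_mul, Finset.mul_sum, Finset.sum_mul, ← neg_add',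
      ← Finset.sum_add_distrib]
    congr 1
    exact Finset.sum_congr rfl fun i _ => by ring
  have h4 : S * (2 * (1 / (2 * (S + 1))) ^ 2) ≤ 1 := by
    rw [div_pow, one_pow, mul_one_div, mul_div_assoc', div_le_one (by positivity)]
    nlinarith
  have h5 := mul_le_mul_of_nonneg_right h4 (sq_nonneg ‖x‖)
  linarith

/-- The lowest eigenvalue of a semibounded form `‖x‖² + ⟪R x, x⟫`, with `R` compact, relative to
`‖T x‖²`, with `T` compact. -/
theorem exists_ground_state (T : D →L[ℂ] L) (R : D →L[ℂ] D) (hT : IsCompactOperator T)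
    (hT0 : ∃ x, T x ≠ 0) (hR : IsCompactOperator R) (hRs : (R : D →ₗ[ℂ] D).IsSymmetric) (C : ℝ)
    (hC : ∀ x, C * ‖T x‖ ^ 2 ≤ ‖x‖ ^ 2 + (inner ℂ (R x) x).re) :
    ∃ (m : ℝ) (x : D), x ≠ 0 ∧
      (∀ y, m * ‖T y‖ ^ 2 ≤ ‖y‖ ^ 2 + (inner ℂ (R y) y).re) ∧
      ∀ y, inner ℂ x y + inner ℂ (R x) y = m * inner ℂ (T x) (T y) := by
  -- The admissible lower bounds form a closed set, bounded above by any Rayleigh quotient; the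
  -- candidate eigenvalue is its maximum.
  set S : Set ℝ := {m | ∀ y, m * ‖T y‖ ^ 2 ≤ ‖y‖ ^ 2 + (inner ℂ (R y) y).re}
  have hS : S.Nonempty := ⟨C, hC⟩
  have hSb : BddAbove S := by
    obtain ⟨x, hx⟩ := hT0
    have : 0 < ‖T x‖ ^ 2 := by positivity
    exact ⟨(‖x‖ ^ 2 + (inner ℂ (R x) x).re) / ‖T x‖ ^ 2, fun m hm => (le_div_iff₀ this).2 (hm x)⟩
  have hScl : IsClosed S := by
    simp only [S, ofPred_forall]
    exact isClosed_iInter fun y => isClosed_le (by fun_prop) continuous_const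
  set m := sSup S
  have hm : m ∈ S := hScl.csSup_mem hS hSb
  set B : D →L[ℂ] D := R - (m : ℂ) • (ContinuousLinearMap.adjoint T ∘L T)
  have hB : IsCompactOperator B :=
    hR.sub ((hT.clm_comp (ContinuousLinearMap.adjoint T)).smul (m : ℂ))
  have hin : ∀ x y, inner ℂ ((B - (-1 : ℂ) • 1 : D →L[ℂ] D) x) y =
      inner ℂ x y + inner ℂ (R x) y - m * inner ℂ (T x) (T y) := by
    intro x y
    simp [B,
      ContinuousLinearMap.adjoint_inner_left]
    ring
  have hre : ∀ x, (inner ℂ ((B - (-1 : ℂ) • 1 : D →L[ℂ] D) x) x).re =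
      ‖x‖ ^ 2 + (inner ℂ (R x) x).re - m * ‖T x‖ ^ 2 := by
    intro x
    rw [hin, inner_self_eq_norm_sq_to_K, inner_self_eq_norm_sq_to_K]
    simp [← Complex.ofReal_pow]
  -- The form shifted by `m` is represented by `1 + B` with `B` compact. An eigenvector of `B` for
  -- `-1` is precisely a solution of the Euler–Lagrange equation.
  by_cases hev : Module.End.HasEigenvalue (B : Module.End ℂ D) (-1)
  · obtain ⟨x, hx⟩ := hev.exists_hasEigenvector
    refine ⟨m, x, hx.2, hm, fun y => ?_⟩
    have h0 : (B - (-1 : ℂ) • 1 : D →L[ℂ] D) x = 0 := by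
      have := hx.apply_eq_smul
      simp only [ContinuousLinearMap.coe_coe] at this
      simp [this]
    have := hin x y
    rw [h0, inner_zero_left] at this
    exact (sub_eq_zero.1 this.symm)
  · exfalso
    -- Otherwise the Fredholm alternative bounds `1 + B` from below. Together with positivity this
    -- controls `‖T x‖²` by the shifted form, so `m` could be raised by `N⁻¹`, against maximality.
    obtain ⟨K, hK⟩ := hB.antilipschitz_of_not_hasEigenvalue (by norm_num) hev
    set A : D →L[ℂ] D := B - (-1 : ℂ) • 1
    have hsym : (A : D →ₗ[ℂ] D).IsSymmetric := by
      intro x y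
      have h1 := hin x y
      have h2 := hin y x
      have h3 : inner ℂ (R x) y = inner ℂ x (R y) := hRs x y
      change inner ℂ (A x) y = inner ℂ x (A y)
      rw [← inner_conj_symm x (A y), h1, h2]
      simp [h3]
    have hpos : ∀ x, 0 ≤ (inner ℂ (A x) x).re := fun x => by
      rw [hre]; linarith [hm x]
    set N : ℝ := ((K : ℝ) ^ 2 + 1) * (‖A‖ + 1) * (‖T‖ ^ 2 + 1)
    have hN : 0 < N := by positivity
    have hlow : ∀ x, ‖T x‖ ^ 2 ≤ N * (inner ℂ (A x) x).re := by
      intro x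
      have h1 := norm_sq_le_of_re_inner_nonneg A hsym hpos x
      have h2 : ‖x‖ ≤ K * ‖A x‖ := by simpa using hK.le_mul_dist x 0
      have h3 : ‖x‖ ^ 2 ≤ (K : ℝ) ^ 2 * ‖A x‖ ^ 2 := by
        rw [← mul_pow]; gcongr
      have h4 : ‖T x‖ ^ 2 ≤ ‖T‖ ^ 2 * ‖x‖ ^ 2 := by
        rw [← mul_pow]; gcongr; exact T.le_opNorm x
      calc ‖T x‖ ^ 2 ≤ ‖T‖ ^ 2 * ((K : ℝ) ^ 2 * ((‖A‖ + 1) * (inner ℂ (A x) x).re)) := by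
            refine h4.trans ?_
            gcongr
            refine h3.trans ?_
            gcongr
        _ ≤ (‖T‖ ^ 2 + 1) * (((K : ℝ) ^ 2 + 1) * ((‖A‖ + 1) * (inner ℂ (A x) x).re)) := by
            have := mul_nonneg (show 0 ≤ ‖A‖ + 1 by positivity) (hpos x)
            gcongr <;> linarith
        _ = N * (inner ℂ (A x) x).re := by ring
    have : m + N⁻¹ ∈ S := by
      intro y
      have h1 := hlow y
      rw [hre] at h1
      have h2 : N⁻¹ * ‖T y‖ ^ 2 ≤ ‖y‖ ^ 2 + (inner ℂ (R y) y).re - m * ‖T y‖ ^ 2 := by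
        rwa [inv_mul_le_iff₀ hN]
      linarith
    have h1 := le_csSup hSb this
    have h2 : 0 < N⁻¹ := by positivity
    linarith

end GroundState

/-! ### Integral identities on a single edge. -/

theorem intervalIntegral_congr_edge {ℓ : ℝ} (hℓ : 0 ≤ ℓ) {f g : ℝ → ℂ}
    (h : f =ᵐ[edgeMeasure ℓ] g) : ∫ x in (0 : ℝ)..ℓ, f x = ∫ x in (0 : ℝ)..ℓ, g x := by
  rw [intervalIntegral.integral_of_le hℓ, intervalIntegral.integral_of_le hℓ]
  exact integral_congr_ae h

theorem MeasureTheory.MemLp.intervalIntegrable_star_mul {ℓ : ℝ} (hℓ : 0 ≤ ℓ) {f g : ℝ → ℂ}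
    (hf : MemLp f 2 (edgeMeasure ℓ)) (hg : MemLp g 2 (edgeMeasure ℓ)) :
    IntervalIntegrable (fun x => star (f x) * g x) volume 0 ℓ := by
  rw [intervalIntegrable_iff_integrableOn_Ioc_of_le hℓ]
  exact hf.star.integrable_mul hg

theorem isPrimitiveOn_of_memLp {ℓ : ℝ} (hℓ : 0 ≤ ℓ) (c : ℂ) {g : ℝ → ℂ}
    (hg : MemLp g 2 (edgeMeasure ℓ)) : IsPrimitiveOn ℓ (primitiveFrom c g) g :=
  isPrimitiveOn_primitiveFrom c (hg.intervalIntegrable_edge hℓ)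

theorem memLp_ofReal_mul {ℓ : ℝ} {q : ℝ → ℝ} (hq : MemLp q ⊤ (edgeMeasure ℓ)) {u : ℝ → ℂ}
    (hu : ContinuousOn u (Icc 0 ℓ)) : MemLp (fun x => (q x : ℂ) * u x) 2 (edgeMeasure ℓ) :=
  (memLp_edge_of_continuousOn hu).mul' (p := ⊤) hq.ofReal

theorem memLp_ofReal_sub_mul {ℓ : ℝ} {q : ℝ → ℝ} (hq : MemLp q ⊤ (edgeMeasure ℓ)) (m : ℝ)
    {u : ℝ → ℂ} (hu : ContinuousOn u (Icc 0 ℓ)) :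
    MemLp (fun x => ((q x : ℂ) - m) * u x) 2 (edgeMeasure ℓ) := by
  have := (memLp_ofReal_mul hq hu).sub ((memLp_edge_of_continuousOn hu).const_mul (m : ℂ))
  refine this.ae_eq (Filter.Eventually.of_forall fun x => ?_)
  simp only [Pi.sub_apply]
  ring

/-- Integration by parts on one edge: the lower order part of the form is moved onto the derivative
of the test function. -/
theorem edge_form_eq {ℓ : ℝ} (hℓ : 0 < ℓ) {q : ℝ → ℝ} (hq : MemLp q ⊤ (edgeMeasure ℓ)) (m : ℝ)
    {c d : ℂ} {g k : ℝ → ℂ} (hg : MemLp g 2 (edgeMeasure ℓ)) (hk : MemLp k 2 (edgeMeasure ℓ)) :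
    (∫ x in (0 : ℝ)..ℓ, star (g x) * k x) +
        (∫ x in (0 : ℝ)..ℓ, (q x : ℂ) * (star (primitiveFrom c g x) * primitiveFrom d k x)) -
        m * (∫ x in (0 : ℝ)..ℓ, star (primitiveFrom c g x) * primitiveFrom d k x) =
      (∫ x in (0 : ℝ)..ℓ, star (g x -
          primitiveFrom 0 (fun s => ((q s : ℂ) - m) * primitiveFrom c g s) x) * k x) +
        star (primitiveFrom 0 (fun s => ((q s : ℂ) - m) * primitiveFrom c g s) ℓ) *
          primitiveFrom d k ℓ := by
  have hu := isPrimitiveOn_of_memLp hℓ.le c hg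
  have hw := isPrimitiveOn_of_memLp hℓ.le d hk
  have hL := memLp_ofReal_sub_mul hq m hu.continuousOn
  have hG := isPrimitiveOn_of_memLp hℓ.le 0 hL
  have huL := memLp_edge_of_continuousOn hu.continuousOn
  have hwL := memLp_edge_of_continuousOn hw.continuousOn
  have hGL := memLp_edge_of_continuousOn hG.continuousOn
  -- The primitive starts from `0`, so only the boundary term at `ℓ` survives.
  have ibp := hG.conj.integral_add_eq hℓ.le hw
  simp only [primitiveFrom_zero, star_zero, zero_mul, sub_zero] at ibp
  rw [← ibp]
  have i1 := hg.intervalIntegrable_star_mul hℓ.le hk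
  have i2 := hGL.intervalIntegrable_star_mul hℓ.le hk
  have i3 : IntervalIntegrable (fun x => (q x : ℂ) *
      (star (primitiveFrom c g x) * primitiveFrom d k x)) volume 0 ℓ := by
    refine ((memLp_ofReal_mul hq hu.continuousOn).intervalIntegrable_star_mul hℓ.le hwL).congr
      fun x _ => ?_
    simp [mul_assoc]
  have i4 := huL.intervalIntegrable_star_mul hℓ.le hwL
  have e1 : (∫ x in (0 : ℝ)..ℓ, star (g x -
          primitiveFrom 0 (fun s => ((q s : ℂ) - m) * primitiveFrom c g s) x) * k x) =
      (∫ x in (0 : ℝ)..ℓ, star (g x) * k x) - ∫ x in (0 : ℝ)..ℓ,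
        star (primitiveFrom 0 (fun s => ((q s : ℂ) - m) * primitiveFrom c g s) x) * k x := by
    rw [← intervalIntegral.integral_sub i1 i2]
    simp only [star_sub, sub_mul]
  have e2 : (∫ x in (0 : ℝ)..ℓ, star (((q x : ℂ) - m) * primitiveFrom c g x) *
        primitiveFrom d k x) =
      (∫ x in (0 : ℝ)..ℓ, (q x : ℂ) * (star (primitiveFrom c g x) * primitiveFrom d k x)) -
        m * (∫ x in (0 : ℝ)..ℓ, star (primitiveFrom c g x) * primitiveFrom d k x) := by
    rw [← intervalIntegral.integral_const_mul, ← intervalIntegral.integral_sub i3 (i4.const_mul _)]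
    congr 1
    ext x
    simp only [star_mul', star_sub, Complex.star_def, Complex.conj_ofReal]
    ring
  rw [e1, e2]
  ring

/-- The mean value `a` of an `L²` function `r`, with `⟪r, r - a⟫ = ‖r - a‖²`. -/
theorem exists_mean_integral_star_mul_eq {ℓ : ℝ} (hℓ : 0 < ℓ) {r : ℝ → ℂ}
    (hr : MemLp r 2 (edgeMeasure ℓ)) :
    ∃ a : ℂ, (∫ x in (0 : ℝ)..ℓ, (r x - a)) = 0 ∧
      (∫ x in (0 : ℝ)..ℓ, star (r x) * (r x - a)) = ((∫ x in (0 : ℝ)..ℓ, ‖r x - a‖ ^ 2 : ℝ) : ℂ) ∧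
      ((∫ x in (0 : ℝ)..ℓ, ‖r x - a‖ ^ 2) = 0 → r =ᵐ[edgeMeasure ℓ] fun _ => a) := by
  have hi := hr.intervalIntegrable_edge hℓ.le
  set a : ℂ := (ℓ : ℂ)⁻¹ * ∫ x in (0 : ℝ)..ℓ, r x
  have hs : MemLp (fun x => r x - a) 2 (edgeMeasure ℓ) := hr.sub (memLp_const a)
  have h0 : (∫ x in (0 : ℝ)..ℓ, (r x - a)) = 0 := by
    rw [intervalIntegral.integral_sub hi intervalIntegrable_const, intervalIntegral.integral_const]
    have : (ℓ : ℂ) ≠ 0 := by exact_mod_cast hℓ.ne'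
    simp [a]
    field_simp
    simp
  refine ⟨a, h0, ?_, fun h => ?_⟩
  -- The second summand integrates to zero by the choice of `a`.
  · have e : ∀ x, star (r x) * (r x - a) = ((‖r x - a‖ ^ 2 : ℝ) : ℂ) + star a * (r x - a) := by
      intro x
      have : ((‖r x - a‖ ^ 2 : ℝ) : ℂ) = star (r x - a) * (r x - a) := by
        rw [Complex.star_def, Complex.conj_mul']; push_cast; rfl
      rw [this, star_sub]; ring
    simp_rw [e]
    have h2 : IntervalIntegrable (fun x => ((‖r x - a‖ ^ 2 : ℝ) : ℂ)) volume 0 ℓ := by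
      refine (hs.intervalIntegrable_star_mul hℓ.le hs).congr fun x _ => ?_
      rw [Complex.star_def, Complex.conj_mul']; push_cast; rfl
    rw [intervalIntegral.integral_add h2 ((hs.intervalIntegrable_edge hℓ.le).const_mul _),
      intervalIntegral.integral_const_mul, h0, mul_zero, add_zero, intervalIntegral.integral_ofReal]
  · rw [intervalIntegral.integral_of_le hℓ.le,
      integral_eq_zero_iff_of_nonneg (fun x => by positivity) hs.norm.integrable_sq] at h
    filter_upwards [h] with x hx
    have : ‖r x - a‖ ^ 2 = 0 := hx
    exact sub_eq_zero.1 (norm_eq_zero.1 (pow_eq_zero_iff two_ne_zero |>.1 this))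

/-! ### Weak solutions and eigenfunctions. -/

namespace MetricGraph

variable {V E : Type*}

/-- The function on `Γ` with vertex values `c` and edgewise derivative `g` is a well-defined
function of finite energy. -/
structure IsFiniteEnergy (Γ : MetricGraph V E) (c : V → ℂ) (g : E → ℝ → ℂ) : Prop where
  memLp : ∀ e, MemLp (g e) 2 (edgeMeasure (Γ.length e))
  terminus : ∀ e, primitiveFrom (c (Γ.origin e)) (g e) (Γ.length e) = c (Γ.terminus e)

/-- The `L²` inner product of two functions of finite energy. -/
noncomputable def massForm [Fintype E] (Γ : MetricGraph V E) (c : V → ℂ) (g : E → ℝ → ℂ)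
    (d : V → ℂ) (k : E → ℝ → ℂ) : ℂ :=
  ∑ e, ∫ x in (0 : ℝ)..Γ.length e,
    star (primitiveFrom (c (Γ.origin e)) (g e) x) * primitiveFrom (d (Γ.origin e)) (k e) x

/-- The sesquilinear form of the Schrödinger operator. -/
noncomputable def energyForm [Fintype V] [Fintype E] (Γ : MetricGraph V E) (q : E → ℝ → ℝ)
    (α : V → ℝ) (c : V → ℂ) (g : E → ℝ → ℂ) (d : V → ℂ) (k : E → ℝ → ℂ) : ℂ :=
  ∑ e, ((∫ x in (0 : ℝ)..Γ.length e, star (g e x) * k e x) +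
    ∫ x in (0 : ℝ)..Γ.length e, (q e x : ℂ) *
      (star (primitiveFrom (c (Γ.origin e)) (g e) x) * primitiveFrom (d (Γ.origin e)) (k e) x)) +
  ∑ v, (α v : ℂ) * (star (c v) * d v)

variable [Fintype E]

/-- Regrouping edge boundary terms by vertex is what turns integration by parts into the `δ`
condition; a loop contributes to both inner sums at its vertex. -/
theorem sum_origin_terminus [Fintype V] [DecidableEq V] (Γ : MetricGraph V E) (A B : E → ℂ) (d : V → ℂ) :
    ∑ e, (B e * d (Γ.terminus e) - A e * d (Γ.origin e)) =
      ∑ v, (∑ e with Γ.terminus e = v, B e - ∑ e with Γ.origin e = v, A e) * d v := by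
  have h : ∀ (p : E → V) (A : E → ℂ), ∑ e, A e * d (p e) = ∑ v, (∑ e with p e = v, A e) * d v := by
    intro p A
    rw [← Finset.sum_fiberwise Finset.univ p]
    refine Finset.sum_congr rfl fun v _ => ?_
    rw [Finset.sum_mul]
    refine Finset.sum_congr rfl fun e he => ?_
    rw [(Finset.mem_filter.1 he).2]
  simp only [Finset.sum_sub_distrib, sub_mul, h]

/-- A weak solution of the eigenvalue equation is an eigenfunction. -/
theorem mem_schrodingerGraph_of_weak [Fintype V] [DecidableEq V] (Γ : MetricGraph V E) {q : E → ℝ → ℝ}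
    (hq : ∀ e, MemLp (q e) ⊤ (edgeMeasure (Γ.length e))) {α : V → ℝ} {m : ℝ} {c : V → ℂ}
    {g : E → ℝ → ℂ} (h : Γ.IsFiniteEnergy c g)
    (hw : ∀ d k, Γ.IsFiniteEnergy d k →
      Γ.energyForm q α c g d k = m * Γ.massForm c g d k) {f : Γ.L2}
    (hf : ∀ e, f e =ᵐ[edgeMeasure (Γ.length e)] primitiveFrom (c (Γ.origin e)) (g e)) :
    (f, (m : ℂ) • f) ∈ Γ.schrodingerGraph q α := by
  have hℓ := fun e => Γ.length_pos e
  set u : E → ℝ → ℂ := fun e => primitiveFrom (c (Γ.origin e)) (g e)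
  set u₂ : E → ℝ → ℂ := fun e x => ((q e x : ℂ) - m) * u e x
  set G : E → ℝ → ℂ := fun e => primitiveFrom 0 (u₂ e)
  have hu : ∀ e, IsPrimitiveOn (Γ.length e) (u e) (g e) := fun e =>
    isPrimitiveOn_of_memLp (hℓ e).le _ (h.memLp e)
  have hu₂ : ∀ e, MemLp (u₂ e) 2 (edgeMeasure (Γ.length e)) := fun e =>
    memLp_ofReal_sub_mul (hq e) m (hu e).continuousOn
  have hG : ∀ e, IsPrimitiveOn (Γ.length e) (G e) (u₂ e) := fun e =>
    isPrimitiveOn_of_memLp (hℓ e).le _ (hu₂ e)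
  have hr : ∀ e, MemLp (fun x => g e x - G e x) 2 (edgeMeasure (Γ.length e)) := fun e =>
    (h.memLp e).sub (memLp_edge_of_continuousOn (hG e).continuousOn)
  have key : ∀ d k, Γ.IsFiniteEnergy d k →
      ∑ e, ((∫ x in (0 : ℝ)..Γ.length e, star (g e x - G e x) * k e x) +
        star (G e (Γ.length e)) * d (Γ.terminus e)) + ∑ v, (α v : ℂ) * (star (c v) * d v) = 0 := by
    intro d k hdk
    have e1 := fun e => edge_form_eq (hℓ e) (hq e) m (c := c (Γ.origin e)) (d := d (Γ.origin e))
      (h.memLp e) (hdk.memLp e)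
    simp only [hdk.terminus] at e1
    have := hw d k hdk
    simp only [energyForm, massForm] at this
    rw [Finset.sum_congr rfl fun e _ => (e1 e).symm, Finset.sum_sub_distrib, ← Finset.mul_sum,
      ← this]
    ring
  choose a ha0 ha1 ha2 using fun e => exists_mean_integral_star_mul_eq (hℓ e) (hr e)
  have hae : ∀ e, g e =ᵐ[edgeMeasure (Γ.length e)] fun x => a e + G e x := by
    -- The test function vanishes at all vertices, which is legitimate because its derivative has
    -- mean zero on each edge. The weak equation becomes `∑ ∫ |g - G - a|² = 0` (du Bois-Reymond),
    -- so `a + G` is the continuous representative of the derivative.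
    have h1 := key 0 (fun e x => g e x - G e x - a e)
      ⟨fun e => (hr e).sub (memLp_const _), fun e => by simp [primitiveFrom, ha0]⟩
    simp only [ha1, Pi.zero_apply, mul_zero, Finset.sum_const_zero, add_zero] at h1
    have h2 : ∑ e, ∫ x in (0 : ℝ)..Γ.length e, ‖g e x - G e x - a e‖ ^ 2 = 0 := by
      exact_mod_cast h1
    rw [Finset.sum_eq_zero_iff_of_nonneg (fun e _ =>
      intervalIntegral.integral_nonneg (hℓ e).le fun x _ => by positivity)] at h2
    intro e
    filter_upwards [ha2 e (h2 e (Finset.mem_univ e))] with x hx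
    rw [← hx]; ring
  refine ⟨u, fun e x => a e + G e x, u₂, fun e => ⟨⟨?_, ?_⟩, ⟨(hG e).1, ?_⟩, hu₂ e⟩, ⟨c, ?_, ?_⟩,
    hf, ?_⟩
  · exact ((h.memLp e).ae_eq (hae e)).intervalIntegrable_edge (hℓ e).le
  · intro x hx
    rw [show u e x = primitiveFrom (c (Γ.origin e)) (g e) x from rfl,
      primitiveFrom_congr _ (hae e) hx]
    simp only [u, primitiveFrom_zero]
    rfl
  · intro x hx
    beta_reduce
    rw [(hG e).2 x hx]
    ring
  · exact fun e => ⟨primitiveFrom_zero _ _, h.terminus e⟩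
  · intro v
    -- Testing with the edgewise linear interpolation of the indicator of `v` isolates the
    -- derivative condition at `v`.
    have h1 := key (Pi.single v 1) (fun e _ => (Γ.length e : ℂ)⁻¹ *
      ((Pi.single v 1 : V → ℂ) (Γ.terminus e) - (Pi.single v 1 : V → ℂ) (Γ.origin e)))
      ⟨fun e => memLp_const _, fun e => by
        have : (Γ.length e : ℂ) ≠ 0 := by exact_mod_cast (hℓ e).ne'
        rw [primitiveFrom, intervalIntegral.integral_const]
        simp
        field_simp
        ring⟩
    have h2 : ∀ e, (∫ x in (0 : ℝ)..Γ.length e, star (g e x - G e x) * ((Γ.length e : ℂ)⁻¹ *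
        ((Pi.single v 1 : V → ℂ) (Γ.terminus e) - (Pi.single v 1 : V → ℂ) (Γ.origin e)))) =
        star (a e) * ((Pi.single v 1 : V → ℂ) (Γ.terminus e) -
          (Pi.single v 1 : V → ℂ) (Γ.origin e)) := by
      intro e
      have : (Γ.length e : ℂ) ≠ 0 := by exact_mod_cast (hℓ e).ne'
      rw [intervalIntegral_congr_edge (hℓ e).le (g := fun _ => star (a e) * ((Γ.length e : ℂ)⁻¹ *
        ((Pi.single v 1 : V → ℂ) (Γ.terminus e) - (Pi.single v 1 : V → ℂ) (Γ.origin e)))),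
        intervalIntegral.integral_const]
      · simp
        field_simp
      · filter_upwards [hae e] with x hx
        rw [hx, add_sub_cancel_right]
    simp only [h2] at h1
    -- Since `G` vanishes at `0`, the derivative `a + G` equals `a` at the origin and `a + G(ℓ)` at
    -- the terminus.
    have h3 := Γ.sum_origin_terminus (fun e => star (a e))
      (fun e => star (a e) + star (G e (Γ.length e))) (Pi.single v 1)
    rw [Finset.sum_congr rfl (fun e _ => show _ = star (a e) * ((Pi.single v 1 : V → ℂ)
      (Γ.terminus e) - (Pi.single v 1 : V → ℂ) (Γ.origin e)) +
        star (G e (Γ.length e)) * (Pi.single v 1 : V → ℂ) (Γ.terminus e) by ring)] at h3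
    rw [h3] at h1
    simp only [Pi.single_apply, mul_ite, mul_one, mul_zero, Finset.sum_ite_eq', Finset.mem_univ,
      if_true] at h1
    have h4 := congrArg star h1
    simp only [star_add, star_sub, star_sum, star_mul', star_zero, Complex.star_def,
      Complex.conj_conj, Complex.conj_ofReal] at h4
    simp only [G, primitiveFrom_zero, add_zero]
    simp only [G] at h4
    linear_combination -h4
  · intro e
    filter_upwards [Lp.coeFn_smul (m : ℂ) (f e), hf e] with x h1 h2
    refine h1.trans ?_
    rw [Pi.smul_apply, h2, smul_eq_mul]
    simp only [u₂, u]
    ring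

theorem mem_eigenvalues_iff [DecidableEq V] (Γ : MetricGraph V E) (q : E → ℝ → ℝ) (α : V → ℝ) (m : ℝ) :
    m ∈ Γ.eigenvalues q α ↔ ∃ f : Γ.L2, f ≠ 0 ∧ (f, (m : ℂ) • f) ∈ Γ.schrodingerGraph q α := by
  rw [← Γ.schrodinger_graph q α]
  constructor
  · rintro ⟨f, hf, h⟩
    exact ⟨f, hf, by rw [← h]; exact LinearPMap.mem_graph _ f⟩
  · rintro ⟨f, hf, h⟩
    rw [LinearPMap.mem_graph_iff] at h
    obtain ⟨y, hy, hy'⟩ := h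
    exact ⟨y, by rwa [hy], by rw [hy', hy]⟩

theorem inner_eq_massForm (Γ : MetricGraph V E) {c d : V → ℂ} {g k : E → ℝ → ℂ} {f f' : Γ.L2}
    (hf : ∀ e, f e =ᵐ[edgeMeasure (Γ.length e)] primitiveFrom (c (Γ.origin e)) (g e))
    (hf' : ∀ e, f' e =ᵐ[edgeMeasure (Γ.length e)] primitiveFrom (d (Γ.origin e)) (k e)) :
    inner ℂ f f' = Γ.massForm c g d k := by
  rw [PiLp.inner_apply, massForm]
  refine Finset.sum_congr rfl fun e _ => ?_
  rw [L2.inner_def, intervalIntegral.integral_of_le (Γ.length_pos e).le]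
  refine integral_congr_ae ?_
  filter_upwards [hf e, hf' e] with x h1 h2
  rw [h1, h2, RCLike.inner_apply, mul_comm]
  rfl

/-- An eigenfunction is a function of finite energy, and its energy is the eigenvalue times its
mass. -/
theorem exists_energyForm_eq_of_mem_eigenvalues [Fintype V] [DecidableEq V] (Γ : MetricGraph V E) {q : E → ℝ → ℝ} {α : V → ℝ} {m : ℝ}
    (hm : m ∈ Γ.eigenvalues q α) : ∃ c g, Γ.IsFiniteEnergy c g ∧
      0 < (Γ.massForm c g c g).re ∧ Γ.energyForm q α c g c g = m * Γ.massForm c g c g := by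
  obtain ⟨f, hf0, u, u₁, u₂, hu, ⟨c, hc, hk⟩, hf, hg⟩ := (Γ.mem_eigenvalues_iff q α m).1 hm
  have hℓ := fun e => Γ.length_pos e
  have hL : ∀ e, MemLp (u₁ e) 2 (edgeMeasure (Γ.length e)) := fun e =>
    memLp_edge_of_continuousOn (hu e).primitive_deriv.continuousOn
  have hP : ∀ e, ∀ x ∈ Icc 0 (Γ.length e), primitiveFrom (c (Γ.origin e)) (u₁ e) x = u e x := by
    intro e x hx
    rw [(hu e).primitive.2 x hx, (hc e).1, primitiveFrom]
  have hf' : ∀ e, f e =ᵐ[edgeMeasure (Γ.length e)] primitiveFrom (c (Γ.origin e)) (u₁ e) := by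
    intro e
    filter_upwards [hf e, ae_restrict_mem measurableSet_Ioc] with x h1 h2
    rw [hP e x (Ioc_subset_Icc_self h2)]
    exact h1
  refine ⟨c, u₁, ⟨hL, fun e => ?_⟩, ?_, ?_⟩
  · rw [hP e _ ⟨(hℓ e).le, le_rfl⟩, (hc e).2]
  · rw [← Γ.inner_eq_massForm hf' hf', inner_self_eq_norm_sq_to_K]
    simp only [Complex.coe_algebraMap, ← Complex.ofReal_pow, Complex.ofReal_re]
    positivity
  · rw [energyForm, massForm]
    have key : ∀ e, (∫ x in (0 : ℝ)..Γ.length e, star (u₁ e x) * u₁ e x) +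
        (∫ x in (0 : ℝ)..Γ.length e, (q e x : ℂ) * (star (primitiveFrom (c (Γ.origin e)) (u₁ e) x) *
          primitiveFrom (c (Γ.origin e)) (u₁ e) x)) =
        m * (∫ x in (0 : ℝ)..Γ.length e, star (primitiveFrom (c (Γ.origin e)) (u₁ e) x) *
          primitiveFrom (c (Γ.origin e)) (u₁ e) x) +
        (star (u₁ e (Γ.length e)) * c (Γ.terminus e) - star (u₁ e 0) * c (Γ.origin e)) := by
      intro e
      have hp := isPrimitiveOn_of_memLp (hℓ e).le (c (Γ.origin e)) (hL e)
      have ibp := (hu e).primitive_deriv.conj.integral_add_eq (hℓ e).le hp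
      rw [primitiveFrom_zero, hP e _ ⟨(hℓ e).le, le_rfl⟩, (hc e).2] at ibp
      have hpL := memLp_edge_of_continuousOn hp.continuousOn
      have i1 := (hu e).memLp.intervalIntegrable_star_mul (hℓ e).le hpL
      have i2 := hpL.intervalIntegrable_star_mul (hℓ e).le hpL
      have e1 : (∫ x in (0 : ℝ)..Γ.length e, (q e x : ℂ) *
          (star (primitiveFrom (c (Γ.origin e)) (u₁ e) x) *
          primitiveFrom (c (Γ.origin e)) (u₁ e) x)) =
          m * (∫ x in (0 : ℝ)..Γ.length e, star (primitiveFrom (c (Γ.origin e)) (u₁ e) x) *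
          primitiveFrom (c (Γ.origin e)) (u₁ e) x) + ∫ x in (0 : ℝ)..Γ.length e,
            star (u₂ e x) * primitiveFrom (c (Γ.origin e)) (u₁ e) x := by
        rw [← intervalIntegral.integral_const_mul,
          ← intervalIntegral.integral_add (i2.const_mul _) i1]
        refine intervalIntegral_congr_edge (hℓ e).le ?_
        filter_upwards [hg e, hf e, Lp.coeFn_smul (m : ℂ) (f e),
          ae_restrict_mem measurableSet_Ioc] with x h1 h2 h3 h4
        have h5 : (m : ℂ) * u e x = -u₂ e x + (q e x : ℂ) * u e x := by
          rw [← h1, ← h2]; exact h3.symm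
        have h6 := congrArg star h5
        simp only [star_add, star_neg, star_mul', Complex.star_def, Complex.conj_ofReal] at h6
        rw [hP e x (Ioc_subset_Icc_self h4)]
        simp only [Complex.star_def]
        linear_combination (-u e x) * h6
      rw [e1, ← ibp]
      ring
    simp only [key]
    -- Collected at `v`, the boundary terms equal `-α v |c v|²` by the vertex condition and cancel
    -- the coupling term.
    rw [Finset.sum_add_distrib, ← Finset.mul_sum,
      Γ.sum_origin_terminus (fun e => star (u₁ e 0)) (fun e => star (u₁ e (Γ.length e))),
      add_assoc, ← Finset.sum_add_distrib, add_eq_left]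
    refine Finset.sum_eq_zero fun v _ => ?_
    have h4 := congrArg star (hk v)
    simp only [star_sub, star_sum, star_mul', Complex.star_def, Complex.conj_ofReal] at h4
    simp only [Complex.star_def]
    linear_combination (-c v) * h4

end MetricGraph

/-! ### Operators on direct sums and multiplication by the potential. -/

/-- The operator into a finite `ℓ²` direct sum with given components. -/
noncomputable def ContinuousLinearMap.toPiLp {ι X : Type*} [Fintype ι] {F : ι → Type*}
    [NormedAddCommGroup X] [NormedSpace ℂ X] [∀ i, NormedAddCommGroup (F i)]
    [∀ i, NormedSpace ℂ (F i)] (A : ∀ i, X →L[ℂ] F i) : X →L[ℂ] PiLp 2 F :=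
  (PiLp.continuousLinearEquiv 2 ℂ F).symm.toContinuousLinearMap ∘L ContinuousLinearMap.pi A

theorem isCompactOperator_toPiLp {ι X : Type*} [Fintype ι] {F : ι → Type*}
    [NormedAddCommGroup X] [NormedSpace ℂ X] [∀ i, NormedAddCommGroup (F i)]
    [∀ i, NormedSpace ℂ (F i)] {A : ∀ i, X →L[ℂ] F i} (hA : ∀ i, IsCompactOperator (A i)) :
    IsCompactOperator (ContinuousLinearMap.toPiLp A) := by
  have : IsCompactOperator (ContinuousLinearMap.pi A) := by
    choose K hK hK' using hA
    refine ⟨Set.univ.pi K, isCompact_univ_pi hK, ?_⟩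
    filter_upwards [Filter.iInter_mem.2 hK'] with x hx i _
    exact mem_iInter.1 hx i
  exact this.clm_comp (PiLp.continuousLinearEquiv 2 ℂ F).symm.toContinuousLinearMap

/-- Multiplication by a bounded real function on `L²(0, ℓ)`. -/
noncomputable def edgeMul {ℓ : ℝ} {q : ℝ → ℝ} (hq : MemLp q ⊤ (edgeMeasure ℓ)) :
    Lp ℂ 2 (edgeMeasure ℓ) →L[ℂ] Lp ℂ 2 (edgeMeasure ℓ) :=
  (ContinuousLinearMap.mul ℂ ℂ).holderL (edgeMeasure ℓ) ⊤ 2 2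
    ((hq.ofReal : MemLp (fun x => (q x : ℂ)) ⊤ (edgeMeasure ℓ)).toLp)

theorem coeFn_edgeMul {ℓ : ℝ} {q : ℝ → ℝ} (hq : MemLp q ⊤ (edgeMeasure ℓ))
    (f : Lp ℂ 2 (edgeMeasure ℓ)) :
    edgeMul hq f =ᵐ[edgeMeasure ℓ] fun x => (q x : ℂ) * f x := by
  filter_upwards [(ContinuousLinearMap.mul ℂ ℂ).coeFn_holder (r := 2)
    ((hq.ofReal : MemLp (fun x => (q x : ℂ)) ⊤ (edgeMeasure ℓ)).toLp) f,
    (hq.ofReal : MemLp (fun x => (q x : ℂ)) ⊤ (edgeMeasure ℓ)).coeFn_toLp] with x h1 h2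
  refine h1.trans ?_
  rw [h2]
  rfl

theorem inner_edgeMul {ℓ : ℝ} (hℓ : 0 ≤ ℓ) {q : ℝ → ℝ} (hq : MemLp q ⊤ (edgeMeasure ℓ))
    (f f' : Lp ℂ 2 (edgeMeasure ℓ)) {u u' : ℝ → ℂ} (hu : f =ᵐ[edgeMeasure ℓ] u)
    (hu' : f' =ᵐ[edgeMeasure ℓ] u') :
    inner ℂ (edgeMul hq f) f' = ∫ x in (0 : ℝ)..ℓ, (q x : ℂ) * (star (u x) * u' x) := by
  rw [L2.inner_def, intervalIntegral.integral_of_le hℓ]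
  refine integral_congr_ae ?_
  filter_upwards [coeFn_edgeMul hq f, hu, hu'] with x h1 h2 h3
  rw [h1, h2, h3, RCLike.inner_apply, map_mul]
  simp only [Complex.conj_ofReal, Complex.star_def]
  ring

theorem edgeMul_symm {ℓ : ℝ} {q : ℝ → ℝ} (hq : MemLp q ⊤ (edgeMeasure ℓ))
    (f f' : Lp ℂ 2 (edgeMeasure ℓ)) :
    inner ℂ (edgeMul hq f) f' = inner ℂ f (edgeMul hq f') := by
  rw [L2.inner_def, L2.inner_def]
  refine integral_congr_ae ?_
  filter_upwards [coeFn_edgeMul hq f, coeFn_edgeMul hq f'] with x h1 h2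
  rw [h1, h2, RCLike.inner_apply, RCLike.inner_apply, map_mul]
  simp only [Complex.conj_ofReal]
  ring

/-! ### The energy space and the variational principle. -/

namespace MetricGraph

variable {V E : Type*}

/-- The Hilbert space of vertex values and edgewise derivatives. -/
abbrev JetSpace (Γ : MetricGraph V E) : Type _ := WithLp 2 (EuclideanSpace ℂ V × Γ.L2)

/-- The vertex value at `v`. -/
noncomputable def vertexL (Γ : MetricGraph V E) (v : V) : Γ.JetSpace →L[ℂ] ℂ :=
  (EuclideanSpace.proj v : EuclideanSpace ℂ V →L[ℂ] ℂ) ∘L WithLp.fstL 2 ℂ (EuclideanSpace ℂ V) Γ.L2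

/-- The derivative on the edge `e`. -/
noncomputable def edgeL (Γ : MetricGraph V E) (e : E) :
    Γ.JetSpace →L[ℂ] Lp ℂ 2 (edgeMeasure (Γ.length e)) :=
  PiLp.proj 2 (fun e : E => Lp ℂ 2 (edgeMeasure (Γ.length e))) e ∘L
    WithLp.sndL 2 ℂ (EuclideanSpace ℂ V) Γ.L2

/-- The jump at the terminus of the edge `e` of the function with given vertex values and
derivative. -/
noncomputable def jumpL (Γ : MetricGraph V E) (e : E) : Γ.JetSpace →L[ℂ] ℂ :=
  Γ.vertexL (Γ.terminus e) - (Γ.vertexL (Γ.origin e) +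
    (BoundedContinuousFunction.evalCLM ℂ
      (⟨Γ.length e, (Γ.length_pos e).le, le_rfl⟩ : Icc 0 (Γ.length e))) ∘L
        volterraCont (Γ.length_pos e) ∘L Γ.edgeL e)

theorem jumpL_apply (Γ : MetricGraph V E) (e : E) (x : Γ.JetSpace) :
    Γ.jumpL e x = Γ.vertexL (Γ.terminus e) x -
      primitiveFrom (Γ.vertexL (Γ.origin e) x) (Γ.edgeL e x) (Γ.length e) := by
  simp only [jumpL, primitiveFrom]
  rw [← volterraCont_apply (Γ.length_pos e) _ ⟨Γ.length e, (Γ.length_pos e).le, le_rfl⟩]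
  rfl

theorem JetSpace.eq_zero (Γ : MetricGraph V E) {x : Γ.JetSpace} (h1 : ∀ v, Γ.vertexL v x = 0)
    (h2 : ∀ e, Γ.edgeL e x = 0) : x = 0 := by
  have e1 : x.fst = 0 := by ext v; exact h1 v
  have e2 : x.snd = 0 := by ext1 e; exact h2 e
  apply (WithLp.ofLp_injective 2)
  exact Prod.ext e1 e2

/-- The functions of finite energy as a closed subspace of `JetSpace Γ`. -/
noncomputable def energySubmodule (Γ : MetricGraph V E) : Submodule ℂ Γ.JetSpace :=
  ⨅ e, (Γ.jumpL e).ker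

theorem mem_energySubmodule_iff (Γ : MetricGraph V E) (x : Γ.JetSpace) :
    x ∈ Γ.energySubmodule ↔ ∀ e,
      primitiveFrom (Γ.vertexL (Γ.origin e) x) (Γ.edgeL e x) (Γ.length e) =
        Γ.vertexL (Γ.terminus e) x := by
  simp only [energySubmodule, Submodule.mem_iInf]
  refine forall_congr' fun e => ?_
  rw [LinearMap.mem_ker, ContinuousLinearMap.coe_coe, jumpL_apply, sub_eq_zero, eq_comm]

variable [Fintype V] [Fintype E]

/-- The space of functions of finite energy, i.e. the Sobolev space `H¹(Γ)`. -/
def EnergySpace (Γ : MetricGraph V E) : Type _ := Γ.energySubmodule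

noncomputable instance (Γ : MetricGraph V E) : NormedAddCommGroup Γ.EnergySpace :=
  inferInstanceAs (NormedAddCommGroup Γ.energySubmodule)

noncomputable instance (Γ : MetricGraph V E) : InnerProductSpace ℂ Γ.EnergySpace :=
  inferInstanceAs (InnerProductSpace ℂ Γ.energySubmodule)

instance (Γ : MetricGraph V E) : CompleteSpace Γ.EnergySpace := by
  refine IsClosed.completeSpace_coe (s := (Γ.energySubmodule : Set Γ.JetSpace)) (hs := ?_)
  rw [energySubmodule, Submodule.coe_iInf]
  exact isClosed_iInter fun e => (Γ.jumpL e).isClosed_ker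

/-- The inclusion of `EnergySpace Γ` into `JetSpace Γ`. -/
noncomputable def toJet (Γ : MetricGraph V E) : Γ.EnergySpace →L[ℂ] Γ.JetSpace :=
  Γ.energySubmodule.subtypeL

theorem toJet_mem (Γ : MetricGraph V E) (x : Γ.EnergySpace) : Γ.toJet x ∈ Γ.energySubmodule :=
  Subtype.property (p := fun y => y ∈ Γ.energySubmodule) x

theorem inner_toJet (Γ : MetricGraph V E) (x y : Γ.EnergySpace) :
    inner ℂ (Γ.toJet x) (Γ.toJet y) = inner ℂ x y := rfl

theorem injective_toJet (Γ : MetricGraph V E) : Function.Injective Γ.toJet :=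
  Subtype.val_injective

/-- The embedding of the functions of finite energy into `L²(Γ)`. -/
noncomputable def energyToL2 (Γ : MetricGraph V E) : Γ.EnergySpace →L[ℂ] Γ.L2 :=
  ContinuousLinearMap.toPiLp fun e =>
    primitiveL (Γ.length_pos e) ∘L
      (((Γ.vertexL (Γ.origin e)).prod (Γ.edgeL e)) ∘L Γ.toJet)

theorem isCompactOperator_energyToL2 (Γ : MetricGraph V E) : IsCompactOperator Γ.energyToL2 :=
  isCompactOperator_toPiLp fun e => (isCompactOperator_primitiveL (Γ.length_pos e)).comp_clm _

theorem coeFn_energyToL2 (Γ : MetricGraph V E) (x : Γ.EnergySpace) (e : E) :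
    Γ.energyToL2 x e =ᵐ[edgeMeasure (Γ.length e)]
      primitiveFrom (Γ.vertexL (Γ.origin e) (Γ.toJet x)) (Γ.edgeL e (Γ.toJet x)) :=
  coeFn_primitiveL (Γ.length_pos e) _

theorem isFiniteEnergy_coe (Γ : MetricGraph V E) (x : Γ.EnergySpace) :
    Γ.IsFiniteEnergy (fun v => Γ.vertexL v (Γ.toJet x)) (fun e => Γ.edgeL e (Γ.toJet x)) :=
  ⟨fun _ => Lp.memLp _, (Γ.mem_energySubmodule_iff _).1 (Γ.toJet_mem x)⟩

/-- A continuous function vanishing almost everywhere vanishes at the edge ends. Positive degree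
then kills every vertex value; an isolated vertex would carry a value invisible in `L²`. -/
theorem injective_energyToL2 (Γ : MetricGraph V E) (hΓ : Γ.NoIsolatedVertex) :
    Function.Injective Γ.energyToL2 := by
  rw [injective_iff_map_eq_zero]
  intro x hx
  have hℓ := fun e => Γ.length_pos e
  have hp := fun e => isPrimitiveOn_of_memLp (hℓ e).le (Γ.vertexL (Γ.origin e) (Γ.toJet x))
    (Lp.memLp (Γ.edgeL e (Γ.toJet x)))
  have hz : ∀ e, EqOn (primitiveFrom (Γ.vertexL (Γ.origin e) (Γ.toJet x)) (Γ.edgeL e (Γ.toJet x))) 0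
      (Icc 0 (Γ.length e)) := by
    intro e
    refine (hp e).eqOn_zero (hℓ e) ((Γ.coeFn_energyToL2 x e).symm.trans ?_)
    rw [hx]
    exact Lp.coeFn_zero ℂ 2 (edgeMeasure (Γ.length e))
  refine Γ.injective_toJet ((JetSpace.eq_zero Γ (fun v => ?_) fun e => ?_).trans (map_zero _).symm)
  · obtain ⟨e, rfl | rfl⟩ := hΓ v
    · simpa [primitiveFrom_zero] using hz e ⟨le_rfl, (hℓ e).le⟩
    · rw [← (Γ.mem_energySubmodule_iff _).1 (Γ.toJet_mem x) e]
      exact hz e ⟨(hℓ e).le, le_rfl⟩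
  · refine Lp.ext (((hp e).deriv_ae_zero (hℓ e) (hz e)).trans ?_)
    exact (Lp.coeFn_zero ℂ 2 (edgeMeasure (Γ.length e))).symm

theorem IsFiniteEnergy.exists_toJet {Γ : MetricGraph V E} {c : V → ℂ} {g : E → ℝ → ℂ}
    (h : Γ.IsFiniteEnergy c g) : ∃ x : Γ.EnergySpace, (∀ v, Γ.vertexL v (Γ.toJet x) = c v) ∧
      ∀ e, Γ.edgeL e (Γ.toJet x) =ᵐ[edgeMeasure (Γ.length e)] g e := by
  set x : Γ.JetSpace := WithLp.toLp 2 (WithLp.toLp 2 c, WithLp.toLp 2 fun e => (h.memLp e).toLp)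
  have h1 : ∀ v, Γ.vertexL v x = c v := fun v => rfl
  have h2 : ∀ e, Γ.edgeL e x =ᵐ[edgeMeasure (Γ.length e)] g e := fun e =>
    (h.memLp e).coeFn_toLp
  refine ⟨⟨x, (Γ.mem_energySubmodule_iff x).2 fun e => ?_⟩, h1, h2⟩
  rw [h1, h1, ← h.terminus e]
  exact primitiveFrom_congr _ (h2 e) ⟨(Γ.length_pos e).le, le_rfl⟩

/-- Multiplication by the potential. -/
noncomputable def potentialL (Γ : MetricGraph V E) {q : E → ℝ → ℝ}
    (hq : ∀ e, MemLp (q e) ⊤ (edgeMeasure (Γ.length e))) : Γ.L2 →L[ℂ] Γ.L2 :=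
  ContinuousLinearMap.toPiLp fun e => edgeMul (hq e) ∘L
    PiLp.proj 2 (fun e : E => Lp ℂ 2 (edgeMeasure (Γ.length e))) e

/-- The vector of vertex values of a function of finite energy. -/
noncomputable def vertexValues (Γ : MetricGraph V E) : Γ.EnergySpace →L[ℂ] EuclideanSpace ℂ V :=
  WithLp.fstL 2 ℂ (EuclideanSpace ℂ V) Γ.L2 ∘L Γ.toJet

/-- The diagonal operator on the vertex values with entries `α v - 1`. -/
noncomputable def couplingL (α : V → ℝ) : EuclideanSpace ℂ V →L[ℂ] EuclideanSpace ℂ V :=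
  ContinuousLinearMap.toPiLp fun v => ((α v - 1 : ℝ) : ℂ) •
    (EuclideanSpace.proj v : EuclideanSpace ℂ V →L[ℂ] ℂ)

/-- The lower order part of the form of the Schrödinger operator, as an operator on the space of
functions of finite energy. -/
noncomputable def lowerOrderL (Γ : MetricGraph V E) {q : E → ℝ → ℝ}
    (hq : ∀ e, MemLp (q e) ⊤ (edgeMeasure (Γ.length e))) (α : V → ℝ) :
    Γ.EnergySpace →L[ℂ] Γ.EnergySpace :=
  ContinuousLinearMap.adjoint Γ.energyToL2 ∘L (Γ.potentialL hq ∘L Γ.energyToL2) +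
    ContinuousLinearMap.adjoint Γ.vertexValues ∘L (couplingL α ∘L Γ.vertexValues)

theorem inner_lowerOrderL (Γ : MetricGraph V E) {q : E → ℝ → ℝ}
    (hq : ∀ e, MemLp (q e) ⊤ (edgeMeasure (Γ.length e))) (α : V → ℝ) (x y : Γ.EnergySpace) :
    inner ℂ (Γ.lowerOrderL hq α x) y =
      ∑ e, inner ℂ (edgeMul (hq e) (Γ.energyToL2 x e)) (Γ.energyToL2 y e) +
      ∑ v, ((α v - 1 : ℝ) : ℂ) * (star (Γ.vertexL v (Γ.toJet x)) * Γ.vertexL v (Γ.toJet y)) := by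
  simp only [lowerOrderL, add_apply, ContinuousLinearMap.comp_apply,
    inner_add_left, ContinuousLinearMap.adjoint_inner_left, PiLp.inner_apply]
  congr 1
  refine Finset.sum_congr rfl fun v _ => ?_
  change inner ℂ (((α v - 1 : ℝ) : ℂ) • Γ.vertexL v (Γ.toJet x)) (Γ.vertexL v (Γ.toJet y)) = _
  rw [inner_smul_left, RCLike.inner_apply, Complex.conj_ofReal, mul_comm (Γ.vertexL v (Γ.toJet y))]
  rfl

theorem isSymmetric_lowerOrderL (Γ : MetricGraph V E) {q : E → ℝ → ℝ}
    (hq : ∀ e, MemLp (q e) ⊤ (edgeMeasure (Γ.length e))) (α : V → ℝ) :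
    (Γ.lowerOrderL hq α : Γ.EnergySpace →ₗ[ℂ] Γ.EnergySpace).IsSymmetric := by
  intro x y
  simp only [ContinuousLinearMap.coe_coe]
  rw [← inner_conj_symm x, inner_lowerOrderL, inner_lowerOrderL, map_add, map_sum, map_sum]
  congr 1
  · refine Finset.sum_congr rfl fun e _ => ?_
    rw [inner_conj_symm, edgeMul_symm]
  · refine Finset.sum_congr rfl fun v _ => ?_
    simp only [map_mul, Complex.conj_ofReal, Complex.star_def, Complex.conj_conj]
    ring

/-- The potential term factors through the compact embedding into `L²`, the coupling term through
the finite-dimensional space of vertex values. -/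
theorem isCompactOperator_lowerOrderL (Γ : MetricGraph V E) {q : E → ℝ → ℝ}
    (hq : ∀ e, MemLp (q e) ⊤ (edgeMeasure (Γ.length e))) (α : V → ℝ) :
    IsCompactOperator (Γ.lowerOrderL hq α) := by
  have h1 := (Γ.isCompactOperator_energyToL2.clm_comp (Γ.potentialL hq)).clm_comp
    (ContinuousLinearMap.adjoint Γ.energyToL2)
  have h2 := ((isCompactOperator_of_locallyCompactSpace_dom Γ.vertexValues).clm_comp
    (couplingL α)).clm_comp (ContinuousLinearMap.adjoint Γ.vertexValues)
  exact h1.add h2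

/-- The dictionary between the Hilbert space setting and the explicit forms. The energy inner
product already contains `∑ star (c v) * d v`, which is why `couplingL` has entries `α v - 1`. -/
theorem inner_add_inner_lowerOrderL (Γ : MetricGraph V E) {q : E → ℝ → ℝ}
    (hq : ∀ e, MemLp (q e) ⊤ (edgeMeasure (Γ.length e))) (α : V → ℝ) (x y : Γ.EnergySpace)
    {c d : V → ℂ} {g k : E → ℝ → ℂ} (hc : ∀ v, Γ.vertexL v (Γ.toJet x) = c v)
    (hg : ∀ e, Γ.edgeL e (Γ.toJet x) =ᵐ[edgeMeasure (Γ.length e)] g e) (hd : ∀ v, Γ.vertexL v (Γ.toJet y) = d v)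
    (hk : ∀ e, Γ.edgeL e (Γ.toJet y) =ᵐ[edgeMeasure (Γ.length e)] k e) :
    inner ℂ x y + inner ℂ (Γ.lowerOrderL hq α x) y = Γ.energyForm q α c g d k ∧
      inner ℂ (Γ.energyToL2 x) (Γ.energyToL2 y) = Γ.massForm c g d k := by
  have hT : ∀ (x : Γ.EnergySpace) {c : V → ℂ} {g : E → ℝ → ℂ} (_ : ∀ v, Γ.vertexL v (Γ.toJet x) = c v)
      (_ : ∀ e, Γ.edgeL e (Γ.toJet x) =ᵐ[edgeMeasure (Γ.length e)] g e) (e : E),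
      Γ.energyToL2 x e =ᵐ[edgeMeasure (Γ.length e)] primitiveFrom (c (Γ.origin e)) (g e) := by
    intro x c g hc hg e
    filter_upwards [Γ.coeFn_energyToL2 x e, ae_restrict_mem measurableSet_Ioc] with s h1 h2
    rw [h1, hc]
    exact primitiveFrom_congr _ (hg e) (Ioc_subset_Icc_self h2)
  refine ⟨?_, Γ.inner_eq_massForm (hT x hc hg) (hT y hd hk)⟩
  have e1 : inner ℂ x y = ∑ v, star (c v) * d v + ∑ e, inner ℂ (Γ.edgeL e (Γ.toJet x)) (Γ.edgeL e (Γ.toJet y)) := by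
    rw [← Γ.inner_toJet, WithLp.prod_inner_apply, PiLp.inner_apply, PiLp.inner_apply]
    congr 1
    refine Finset.sum_congr rfl fun v _ => ?_
    rw [← hc, ← hd, RCLike.inner_apply, mul_comm]
    rfl
  rw [e1, inner_lowerOrderL, energyForm, Finset.sum_add_distrib]
  have e2 : ∀ e, inner ℂ (Γ.edgeL e (Γ.toJet x)) (Γ.edgeL e (Γ.toJet y)) =
      ∫ s in (0 : ℝ)..Γ.length e, star (g e s) * k e s := by
    intro e
    rw [L2.inner_def, intervalIntegral.integral_of_le (Γ.length_pos e).le]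
    refine integral_congr_ae ?_
    filter_upwards [hg e, hk e] with s h1 h2
    rw [h1, h2, RCLike.inner_apply, mul_comm]
    rfl
  simp only [e2, fun e => inner_edgeMul (Γ.length_pos e).le (hq e) _ _ (hT x hc hg e) (hT y hd hk e),
    hc, hd]
  have e3 : ∑ v, (α v : ℂ) * (star (c v) * d v) = ∑ v, star (c v) * d v +
      ∑ v, ((α v - 1 : ℝ) : ℂ) * (star (c v) * d v) := by
    rw [← Finset.sum_add_distrib]
    refine Finset.sum_congr rfl fun v _ => ?_
    push_cast
    ring
  rw [e3]
  ring

/-- The vertex terms are absorbed by `exists_mul_norm_sq_le_add_sum`, and the potential costs at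
most its operator norm times `‖T x‖²`, where `T` is the embedding into `L²`. -/
theorem exists_semibound (Γ : MetricGraph V E) (hΓ : Γ.NoIsolatedVertex) {q : E → ℝ → ℝ}
    (hq : ∀ e, MemLp (q e) ⊤ (edgeMeasure (Γ.length e))) (α : V → ℝ) :
    ∃ C : ℝ, ∀ x, C * ‖Γ.energyToL2 x‖ ^ 2 ≤
      ‖x‖ ^ 2 + (inner ℂ (Γ.lowerOrderL hq α x) x).re := by
  obtain ⟨C, hC⟩ := exists_mul_norm_sq_le_add_sum Γ.energyToL2 (Γ.injective_energyToL2 hΓ)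
    (fun v => Γ.vertexL v ∘L Γ.toJet) (fun v => α v - 1)
  refine ⟨C - ‖Γ.potentialL hq‖, fun x => ?_⟩
  have h1 := hC x
  have h2 : (∑ e, inner ℂ (edgeMul (hq e) (Γ.energyToL2 x e)) (Γ.energyToL2 x e)) =
      inner ℂ (Γ.potentialL hq (Γ.energyToL2 x)) (Γ.energyToL2 x) := by
    rw [PiLp.inner_apply]
    rfl
  have h3 : (∑ v, ((α v - 1 : ℝ) : ℂ) * (star (Γ.vertexL v (Γ.toJet x)) * Γ.vertexL v (Γ.toJet x))) =
      ((∑ v, (α v - 1) * ‖Γ.vertexL v (Γ.toJet x)‖ ^ 2 : ℝ) : ℂ) := by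
    push_cast
    refine Finset.sum_congr rfl fun v _ => ?_
    rw [Complex.star_def, Complex.conj_mul']
  rw [inner_lowerOrderL, h2, h3, Complex.add_re, Complex.ofReal_re]
  have h4 : -(‖Γ.potentialL hq‖ * ‖Γ.energyToL2 x‖ ^ 2) ≤
      (inner ℂ (Γ.potentialL hq (Γ.energyToL2 x)) (Γ.energyToL2 x)).re := by
    refine neg_le_of_abs_le ((Complex.abs_re_le_norm _).trans ((norm_inner_le_norm _ _).trans ?_))
    rw [sq, ← mul_assoc]
    gcongr
    exact (Γ.potentialL hq).le_opNorm _
  simp only [ContinuousLinearMap.comp_apply] at h1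
  linarith

/-- The lowest eigenvalue of the Schrödinger operator exists and is given by the variational
principle. -/
theorem exists_mem_eigenvalues_forall_le [DecidableEq V] [Nonempty V] (Γ : MetricGraph V E)
    (hΓ : Γ.NoIsolatedVertex) {q : E → ℝ → ℝ}
    (hq : ∀ e, MemLp (q e) ⊤ (edgeMeasure (Γ.length e))) (α : V → ℝ) :
    ∃ m ∈ Γ.eigenvalues q α, ∀ c g, Γ.IsFiniteEnergy c g →
      m * (Γ.massForm c g c g).re ≤ (Γ.energyForm q α c g c g).re := by
  obtain ⟨C, hC⟩ := Γ.exists_semibound hΓ hq α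
  have hinj := Γ.injective_energyToL2 hΓ
  have hT0 : ∃ x, Γ.energyToL2 x ≠ 0 := by
    have h1 : Γ.IsFiniteEnergy (fun _ => 1) (fun _ _ => 0) :=
      ⟨fun e => MemLp.zero', fun e => by simp [primitiveFrom]⟩
    obtain ⟨x, hx, -⟩ := h1.exists_toJet
    refine ⟨x, fun h => ?_⟩
    rw [map_eq_zero_iff _ hinj] at h
    have := hx (Classical.arbitrary V)
    simp [h] at this
  obtain ⟨m, x, hx0, hle, hx⟩ := exists_ground_state Γ.energyToL2 (Γ.lowerOrderL hq α)
    Γ.isCompactOperator_energyToL2 hT0 (Γ.isCompactOperator_lowerOrderL hq α)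
    (Γ.isSymmetric_lowerOrderL hq α) C hC
  refine ⟨m, (Γ.mem_eigenvalues_iff q α m).2 ⟨Γ.energyToL2 x, ?_, ?_⟩, ?_⟩
  · rwa [Ne, map_eq_zero_iff _ hinj]
  · refine Γ.mem_schrodingerGraph_of_weak hq (Γ.isFiniteEnergy_coe x) ?_ (Γ.coeFn_energyToL2 x)
    intro d k hdk
    obtain ⟨y, hd, hk⟩ := hdk.exists_toJet
    obtain ⟨e1, e2⟩ := Γ.inner_add_inner_lowerOrderL hq α x y (fun _ => rfl)
      (fun _ => Filter.EventuallyEq.rfl) hd hk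
    rw [← e1, ← e2]
    exact hx y
  · intro c g h
    obtain ⟨y, hd, hk⟩ := h.exists_toJet
    obtain ⟨e1, e2⟩ := Γ.inner_add_inner_lowerOrderL hq α y y hd hk hd hk
    rw [← e1, ← e2, inner_self_eq_norm_sq_to_K, inner_self_eq_norm_sq_to_K]
    have := hle y
    simpa [← Complex.ofReal_pow] using this

/-- An eigenfunction for `μ` is itself admissible, with positive mass and Rayleigh quotient `μ`. -/
theorem isLeast_eigenvalues [DecidableEq V] {Γ : MetricGraph V E} {q : E → ℝ → ℝ} {α : V → ℝ}
    {m : ℝ} (hm : m ∈ Γ.eigenvalues q α) (h : ∀ c g, Γ.IsFiniteEnergy c g →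
      m * (Γ.massForm c g c g).re ≤ (Γ.energyForm q α c g c g).re) :
    IsLeast (Γ.eigenvalues q α) m := by
  refine ⟨hm, fun μ hμ => ?_⟩
  obtain ⟨c, g, hcg, h0, he⟩ := Γ.exists_energyForm_eq_of_mem_eigenvalues hμ
  have := h c g hcg
  rw [he, Complex.re_ofReal_mul] at this
  exact le_of_mul_le_mul_right this h0

end MetricGraph

/-! ### Picone's identity and the flower graph without potential. -/

theorem cos_pos_of_mem_Icc {ℓ k : ℝ} (hk : 0 < k) (hkℓ : k * ℓ / 2 < Real.pi / 2) {x : ℝ}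
    (hx : x ∈ Icc 0 ℓ) : 0 < Real.cos (k * (x - ℓ / 2)) := by
  refine Real.cos_pos_of_mem_Ioo ⟨?_, ?_⟩
  · nlinarith [mul_nonneg hk.le hx.1]
  · nlinarith [mul_le_mul_of_nonneg_left hx.2 hk.le]

/-- Picone's identity for `-f'' = k² f` on an edge, relative to the positive solution
`cos (k (x - ℓ / 2))`. -/
theorem picone_identity {ℓ k : ℝ} (hℓ : 0 < ℓ) (hk : 0 < k) (hkℓ : k * ℓ / 2 < Real.pi / 2)
    {u g : ℝ → ℂ} (hu : IsPrimitiveOn ℓ u g) (hg : MemLp g 2 (edgeMeasure ℓ)) :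
    (∫ x in (0 : ℝ)..ℓ, star (g x + k * Real.tan (k * (x - ℓ / 2)) * u x) *
        (g x + k * Real.tan (k * (x - ℓ / 2)) * u x)) =
      (∫ x in (0 : ℝ)..ℓ, star (g x) * g x) - k ^ 2 * (∫ x in (0 : ℝ)..ℓ, star (u x) * u x) +
        k * Real.tan (k * ℓ / 2) * (star (u ℓ) * u ℓ + star (u 0) * u 0) := by
  -- `θ` is the logarithmic derivative of the cosine; the integrand on the left is `|g - θ u|²`, and
  -- the boundary terms come from integrating `(θ |u|²)'`.
  set θ : ℝ → ℂ := fun x => ((-(k * Real.tan (k * (x - ℓ / 2))) : ℝ) : ℂ)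
  set θ' : ℝ → ℂ := fun x =>
    ((-(k * (1 / Real.cos (k * (x - ℓ / 2)) ^ 2 * k)) : ℝ) : ℂ)
  have hc : ∀ x ∈ Icc 0 ℓ, Real.cos (k * (x - ℓ / 2)) ≠ 0 := fun x hx =>
    (cos_pos_of_mem_Icc hk hkℓ hx).ne'
  have hθ : IsPrimitiveOn ℓ θ θ' := by
    refine IsPrimitiveOn.of_hasDerivAt hℓ.le (fun x hx => ?_) ?_
    · have h1 : HasDerivAt (fun x : ℝ => k * (x - ℓ / 2)) k x := by
        simpa using ((hasDerivAt_id x).sub_const (ℓ / 2)).const_mul k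
      have h2 := ((Real.hasDerivAt_tan (hc x hx)).comp x h1).const_mul k
      exact h2.neg.ofReal_comp
    · refine Complex.continuous_ofReal.comp_continuousOn (ContinuousOn.neg ?_)
      refine continuousOn_const.mul (ContinuousOn.mul ?_ continuousOn_const)
      exact ContinuousOn.div continuousOn_const (by fun_prop) fun x hx => pow_ne_zero 2 (hc x hx)
  have hP := hθ.mul hℓ.le (hu.conj.mul hℓ.le hu)
  have huL := memLp_edge_of_continuousOn hu.continuousOn
  have i1 := hg.intervalIntegrable_star_mul hℓ.le hg
  have i2 := (huL.intervalIntegrable_star_mul hℓ.le huL).const_mul ((k : ℂ) ^ 2)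
  have hb := hP.2 ℓ ⟨hℓ.le, le_rfl⟩
  have e1 : (∫ x in (0 : ℝ)..ℓ, star (g x + k * Real.tan (k * (x - ℓ / 2)) * u x) *
        (g x + k * Real.tan (k * (x - ℓ / 2)) * u x)) =
      ∫ x in (0 : ℝ)..ℓ, ((star (g x) * g x - k ^ 2 * (star (u x) * u x)) -
        (θ' x * (star (u x) * u x) + θ x * (star (g x) * u x + star (u x) * g x))) := by
    refine intervalIntegral_congr_edge hℓ.le ?_
    filter_upwards [ae_restrict_mem measurableSet_Ioc] with x hx
    -- The Riccati equation equivalent to `-f'' = k² f`.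
    have h1 : θ' x = -((k : ℂ) ^ 2 + θ x ^ 2) := by
      have h2 := hc x (Ioc_subset_Icc_self hx)
      simp only [θ', θ]
      norm_cast
      generalize k * (x - ℓ / 2) = y at h2 ⊢
      rw [Real.tan_eq_sin_div_cos]
      field_simp
      rw [Real.cos_sq_add_sin_sq]
    have h2 : (k : ℂ) * Real.tan (k * (x - ℓ / 2)) = -θ x := by simp [θ]
    have h3 : star (θ x) = θ x := Complex.conj_ofReal _
    rw [h1, h2]
    simp only [star_add, star_neg, star_mul', h3]
    ring
  rw [e1, intervalIntegral.integral_sub (i1.sub i2) hP.1, intervalIntegral.integral_sub i1 i2,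
    intervalIntegral.integral_const_mul, eq_sub_of_add_eq' hb.symm]
  have t1 : θ ℓ = -(k * Real.tan (k * ℓ / 2)) := by
    simp only [θ]
    rw [show k * (ℓ - ℓ / 2) = k * ℓ / 2 by ring]
    push_cast
    ring
  have t2 : θ 0 = k * Real.tan (k * ℓ / 2) := by
    simp only [θ]
    rw [show k * (0 - ℓ / 2) = -(k * ℓ / 2) by ring, Real.tan_neg]
    push_cast
    ring
  beta_reduce
  rw [t1, t2]
  ring

theorem re_integral_star_mul_self_nonneg {ℓ : ℝ} (hℓ : 0 ≤ ℓ) (f : ℝ → ℂ) :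
    0 ≤ (∫ x in (0 : ℝ)..ℓ, star (f x) * f x).re := by
  have : ∀ x, star (f x) * f x = ((‖f x‖ ^ 2 : ℝ) : ℂ) := fun x => by
    rw [Complex.star_def, Complex.conj_mul']; push_cast; rfl
  simp_rw [this]
  rw [intervalIntegral.integral_ofReal, Complex.ofReal_re]
  exact intervalIntegral.integral_nonneg hℓ fun x _ => by positivity

namespace MetricGraph

variable {V E : Type*}

/-- Giving all vertices of `Γ` the same value meets every continuity condition, so flower functions
are trial functions on `Γ`. -/
theorem IsFiniteEnergy.of_flower {Γ : MetricGraph V E} {c : Unit → ℂ} {g : E → ℝ → ℂ}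
    (h : Γ.flower.IsFiniteEnergy c g) : Γ.IsFiniteEnergy (fun _ => c ()) g :=
  ⟨h.memLp, h.terminus⟩

variable [Fintype E]

/-- The ground state of the flower graph without potential. -/
theorem sq_mem_eigenvalues_flower [Nonempty E] [DecidableEq Unit] (Γ : MetricGraph V E)
    {q : E → ℝ → ℝ} (hq : ∀ e, q e =ᵐ[edgeMeasure (Γ.length e)] 0) {a k : ℝ}
    (hk : k ∈ Γ.secularSolutions a) :
    k ^ 2 ∈ Γ.flower.eigenvalues q (fun _ => a) := by
  obtain ⟨-, hcos, hsec⟩ := hk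
  have hℓ := fun e => Γ.length_pos e
  set C : E → ℂ := fun e => (Real.cos (k * Γ.length e / 2) : ℂ)
  have hC : ∀ e, C e ≠ 0 := fun e => Complex.ofReal_ne_zero.2 (hcos e)
  -- Dividing by `cos (k ℓ / 2)` makes the value `1` at both ends of every edge, which gives
  -- continuity at the single vertex.
  set u : E → ℝ → ℂ := fun e x => (C e)⁻¹ * (Real.cos (k * (x - Γ.length e / 2)) : ℝ)
  set u₁ : E → ℝ → ℂ := fun e x => (C e)⁻¹ * (-Real.sin (k * (x - Γ.length e / 2)) * k : ℝ)
  set u₂ : E → ℝ → ℂ := fun e x => -(k : ℂ) ^ 2 * u e x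
  have hlin : ∀ e x, HasDerivAt (fun x : ℝ => k * (x - Γ.length e / 2)) k x := fun e x => by
    simpa using ((hasDerivAt_id x).sub_const (Γ.length e / 2)).const_mul k
  have hu : ∀ e, IsPrimitiveOn (Γ.length e) (u e) (u₁ e) := fun e =>
    IsPrimitiveOn.of_hasDerivAt (hℓ e).le (fun x _ =>
      (((Real.hasDerivAt_cos _).comp x (hlin e x)).ofReal_comp).const_mul _)
      (by simp only [u₁]; fun_prop)
  have hu₁ : ∀ e, IsPrimitiveOn (Γ.length e) (u₁ e) (u₂ e) := fun e =>
    IsPrimitiveOn.of_hasDerivAt (hℓ e).le (fun x _ => by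
      have := ((((Real.hasDerivAt_sin _).comp x (hlin e x)).neg.mul_const k).ofReal_comp).const_mul
        (C e)⁻¹
      refine this.congr_deriv ?_
      simp only [u₂, u]
      push_cast
      ring) (by simp only [u₂, u]; fun_prop)
  have huL : ∀ e, MemLp (u e) 2 (edgeMeasure (Γ.length e)) := fun e =>
    memLp_edge_of_continuousOn (hu e).continuousOn
  have hu0 : ∀ e, u e 0 = 1 := fun e => by
    simp only [u, C]
    rw [show k * (0 - Γ.length e / 2) = -(k * Γ.length e / 2) by ring, Real.cos_neg]
    exact inv_mul_cancel₀ (hC e)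
  have huℓ : ∀ e, u e (Γ.length e) = 1 := fun e => by
    simp only [u, C]
    rw [show k * (Γ.length e - Γ.length e / 2) = k * Γ.length e / 2 by ring]
    exact inv_mul_cancel₀ (hC e)
  have hu₁0 : ∀ e, u₁ e 0 - u₁ e (Γ.length e) = ((2 * k * Real.tan (k * Γ.length e / 2) : ℝ) : ℂ) :=
    fun e => by
      simp only [u₁, C]
      rw [show k * (Γ.length e - Γ.length e / 2) = k * Γ.length e / 2 by ring,
        show k * (0 - Γ.length e / 2) = -(k * Γ.length e / 2) by ring, Real.sin_neg,
        Real.tan_eq_sin_div_cos]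
      push_cast
      ring
  rw [mem_eigenvalues_iff]
  refine ⟨WithLp.toLp 2 fun e => (huL e).toLp, fun h => ?_, u, u₁, u₂,
    fun e => ⟨hu e, hu₁ e, (huL e).const_mul _⟩,
    ⟨fun _ => 1, fun e => ⟨hu0 e, huℓ e⟩, fun v => ?_⟩, fun e => (huL e).coeFn_toLp, fun e => ?_⟩
  · obtain ⟨e⟩ := ‹Nonempty E›
    have h1 : (huL e).toLp = 0 := congrFun (congrArg WithLp.ofLp h) e
    have h2 : u e =ᵐ[edgeMeasure (Γ.length e)] 0 := by
      refine (huL e).coeFn_toLp.symm.trans ?_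
      rw [h1]
      exact Lp.coeFn_zero ℂ 2 (edgeMeasure (Γ.length e))
    have h3 := (hu e).eqOn_zero (hℓ e) h2 ⟨le_rfl, (hℓ e).le⟩
    rw [hu0] at h3
    exact one_ne_zero h3
  · have h1 : ∀ p : E → Unit, (Finset.univ.filter fun e => p e = v) = Finset.univ := fun p =>
      Finset.filter_true_of_mem fun _ _ => Subsingleton.elim _ _
    rw [h1, ← Finset.sum_sub_distrib]
    refine (Finset.sum_congr rfl fun e _ => hu₁0 e).trans ?_
    rw [← Complex.ofReal_sum, ← Finset.mul_sum, hsec, mul_one]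
  · filter_upwards [Lp.coeFn_smul ((k ^ 2 : ℝ) : ℂ) (huL e).toLp, (huL e).coeFn_toLp, hq e]
      with x h1 h2 h3
    refine h1.trans ?_
    rw [Pi.smul_apply, h2, h3, smul_eq_mul]
    simp only [u₂]
    push_cast
    simp

/-- The lower bound for the energy on the flower graph without potential. -/
theorem sq_mul_massForm_le_energyForm_flower (Γ : MetricGraph V E)
    {q : E → ℝ → ℝ} (hq : ∀ e, q e =ᵐ[edgeMeasure (Γ.length e)] 0) {a k : ℝ} (hk : 0 < k)
    (hkℓ : ∀ e, k * Γ.length e / 2 < Real.pi / 2) (hsec : k ∈ Γ.secularSolutions a)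
    {c : Unit → ℂ} {g : E → ℝ → ℂ} (h : Γ.flower.IsFiniteEnergy c g) :
    k ^ 2 * (Γ.flower.massForm c g c g).re ≤
      (Γ.flower.energyForm q (fun _ => a) c g c g).re := by
  have hℓ := fun e => Γ.length_pos e
  have h1 : ∀ e, k ^ 2 * (∫ x in (0 : ℝ)..Γ.length e,
      star (primitiveFrom (c ()) (g e) x) * primitiveFrom (c ()) (g e) x).re -
        2 * k * Real.tan (k * Γ.length e / 2) * ‖c ()‖ ^ 2 ≤
      (∫ x in (0 : ℝ)..Γ.length e, star (g e x) * g e x).re := by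
    intro e
    have hp := picone_identity (hℓ e) hk (hkℓ e)
      (isPrimitiveOn_of_memLp (hℓ e).le (c ()) (h.memLp e)) (h.memLp e)
    have hn := re_integral_star_mul_self_nonneg (hℓ e).le fun x =>
      g e x + k * Real.tan (k * (x - Γ.length e / 2)) * primitiveFrom (c ()) (g e) x
    have ht : primitiveFrom (c ()) (g e) (Γ.length e) = c () := h.terminus e
    have hs : star (c ()) * c () + star (c ()) * c () = ((2 * ‖c ()‖ ^ 2 : ℝ) : ℂ) := by
      rw [Complex.star_def, Complex.conj_mul']; push_cast; ring
    rw [hp, primitiveFrom_zero, ht, hs] at hn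
    simp only [Complex.add_re, Complex.sub_re, ← Complex.ofReal_pow, ← Complex.ofReal_mul,
      Complex.ofReal_re, Complex.re_ofReal_mul] at hn
    linarith
  have h2 : ∀ e, (∫ x in (0 : ℝ)..Γ.length e, (q e x : ℂ) *
      (star (primitiveFrom (c ()) (g e) x) * primitiveFrom (c ()) (g e) x)) = 0 := by
    intro e
    rw [intervalIntegral_congr_edge (hℓ e).le (g := fun _ => 0), intervalIntegral.integral_zero]
    filter_upwards [hq e] with x hx
    simp [hx]
  have h3 := Finset.sum_le_sum fun e (_ : e ∈ Finset.univ) => h1 e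
  rw [Finset.sum_sub_distrib, ← Finset.mul_sum, ← Finset.sum_mul, ← Finset.mul_sum,
    hsec.2.2] at h3
  have h4 : (a : ℂ) * (star (c ()) * c ()) = ((a * ‖c ()‖ ^ 2 : ℝ) : ℂ) := by
    rw [Complex.star_def, Complex.conj_mul']; push_cast; rfl
  have h5 : Γ.flower.energyForm q (fun _ => a) c g c g =
      (∑ e, ∫ x in (0 : ℝ)..Γ.length e, star (g e x) * g e x) + ((a * ‖c ()‖ ^ 2 : ℝ) : ℂ) := by
    rw [← h4, energyForm, Fintype.sum_unique (ι := Unit)]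
    congr 1
    refine Finset.sum_congr rfl fun e _ => ?_
    exact (congrArg _ (h2 e)).trans (add_zero _)
  have h6 : Γ.flower.massForm c g c g = ∑ e, ∫ x in (0 : ℝ)..Γ.length e,
      star (primitiveFrom (c ()) (g e) x) * primitiveFrom (c ()) (g e) x := rfl
  rw [h5, h6, Complex.add_re, Complex.ofReal_re, Complex.re_sum, Complex.re_sum]
  linarith

/-- The secular equation of the flower graph has a smallest non-negative solution, which lies below
all poles of the tangents. -/
theorem exists_isLeast_secularSolutions [Nonempty E] (Γ : MetricGraph V E) {a : ℝ} (ha : 0 < a) :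
    ∃ k, 0 < k ∧ (∀ e, k * Γ.length e / 2 < Real.pi / 2) ∧ IsLeast (Γ.secularSolutions a) k := by
  obtain ⟨e₀, he₀⟩ := Finite.exists_max Γ.length
  have hℓ := fun e => Γ.length_pos e
  set F : ℝ → ℝ := fun k => 2 * k * ∑ e, Real.tan (k * Γ.length e / 2)
  have hpi := Real.pi_pos
  -- With `K = 2t / ℓ₀` and `ℓ₀` the maximal length, `t < π/2` keeps `[0, K]` free of poles on every
  -- edge. The bound `t > π/4` gives `2K ≥ π/ℓ₀`, hence `F K ≥ 2K tan t ≥ a`.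
  obtain ⟨t, ht1, ht2, ht3⟩ : ∃ t, Real.pi / 4 < t ∧ t < Real.pi / 2 ∧
      a * Γ.length e₀ / Real.pi ≤ Real.tan t := by
    have h1 := Real.tendsto_tan_pi_div_two.eventually_ge_atTop (a * Γ.length e₀ / Real.pi)
    have h2 : ∀ᶠ t in nhdsWithin (Real.pi / 2) (Iio (Real.pi / 2)),
        t ∈ Ioo (Real.pi / 4) (Real.pi / 2) := Ioo_mem_nhdsLT (by linarith)
    obtain ⟨t, h3, h4⟩ := (h1.and h2).exists
    exact ⟨t, h4.1, h4.2, h3⟩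
  set K := 2 * t / Γ.length e₀
  have hK : 0 < K := div_pos (by linarith) (hℓ e₀)
  have hKt : K * Γ.length e₀ / 2 = t := by
    have := (hℓ e₀).ne'
    simp only [K]
    field_simp
  have hlt : ∀ k, 0 ≤ k → k ≤ K → ∀ e, 0 ≤ k * Γ.length e / 2 ∧ k * Γ.length e / 2 < Real.pi / 2 := by
    intro k hk hkK e
    have h1 : k * Γ.length e ≤ K * Γ.length e₀ :=
      mul_le_mul hkK (he₀ e) (hℓ e).le hK.le
    have := mul_nonneg hk (hℓ e).le
    constructor <;> linarith
  have hcos : ∀ k, 0 ≤ k → k ≤ K → ∀ e, Real.cos (k * Γ.length e / 2) ≠ 0 := by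
    intro k hk hkK e
    obtain ⟨h1, h2⟩ := hlt k hk hkK e
    exact (Real.cos_pos_of_mem_Ioo ⟨by linarith, h2⟩).ne'
  have htan : ∀ k, 0 ≤ k → k ≤ K → ∀ e, 0 ≤ Real.tan (k * Γ.length e / 2) := by
    intro k hk hkK e
    obtain ⟨h1, h2⟩ := hlt k hk hkK e
    exact Real.tan_nonneg_of_nonneg_of_le_pi_div_two h1 h2.le
  have hFc : ContinuousOn F (Icc 0 K) := by
    refine ContinuousOn.mul (by fun_prop) (continuousOn_finsetSum _ fun e _ => ?_)
    intro k hk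
    have := (Real.continuousAt_tan.2 (hcos k hk.1 hk.2 e))
    exact (ContinuousAt.comp (f := fun k => k * Γ.length e / 2) this
      (by fun_prop)).continuousWithinAt
  have hF0 : F 0 = 0 := by simp [F]
  have hFK : a ≤ F K := by
    have h1 : Real.tan t ≤ ∑ e, Real.tan (K * Γ.length e / 2) := by
      rw [← hKt]
      exact Finset.single_le_sum (fun e _ => htan K hK.le le_rfl e) (Finset.mem_univ e₀)
    have h2 : a ≤ 2 * K * Real.tan t := by
      have h3 : Real.pi / Γ.length e₀ ≤ 2 * K := by
        simp only [K]
        rw [mul_div_assoc', div_le_div_iff_of_pos_right (hℓ e₀)]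
        linarith
      calc a = Real.pi / Γ.length e₀ * (a * Γ.length e₀ / Real.pi) := by
            have := (hℓ e₀).ne'
            field_simp
        _ ≤ 2 * K * Real.tan t := by
            have := hℓ e₀
            gcongr
    exact h2.trans (by simp only [F]; gcongr)
  obtain ⟨k, ⟨hk0, hkK⟩, hFk⟩ := intermediate_value_Icc hK.le hFc
    (show a ∈ Icc (F 0) (F K) from ⟨by rw [hF0]; exact ha.le, hFK⟩)
  have hk : 0 < k := by
    refine lt_of_le_of_ne hk0 fun h => ?_
    rw [← h, hF0] at hFk
    exact ha.ne hFk
  refine ⟨k, hk, fun e => (hlt k hk0 hkK e).2, ⟨hk0, hcos k hk0 hkK, hFk⟩, ?_⟩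
  -- A smaller solution would also lie below all poles, where each tangent is increasing and the
  -- factor `2k` makes `F` strictly larger at `k`.
  rintro k' ⟨hk'0, -, hFk'⟩
  by_contra! hlt'
  have h1 : ∑ e, Real.tan (k' * Γ.length e / 2) ≤ ∑ e, Real.tan (k * Γ.length e / 2) := by
    refine Finset.sum_le_sum fun e _ => ?_
    obtain ⟨h1, -⟩ := hlt k' hk'0 (hlt'.le.trans hkK) e
    refine (Real.tan_lt_tan_of_lt_of_lt_pi_div_two (by linarith) (hlt k hk0 hkK e).2 ?_).le
    have := mul_lt_mul_of_pos_right hlt' (hℓ e)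
    linarith
  have h2 : 0 < ∑ e, Real.tan (k * Γ.length e / 2) := by
    by_contra! h
    have : F k ≤ 0 := mul_nonpos_of_nonneg_of_nonpos (by linarith) h
    linarith
  have h3 : 2 * k' * ∑ e, Real.tan (k' * Γ.length e / 2) < F k :=
    calc 2 * k' * ∑ e, Real.tan (k' * Γ.length e / 2)
        ≤ 2 * k' * ∑ e, Real.tan (k * Γ.length e / 2) := by gcongr
      _ < F k := mul_lt_mul_of_pos_right (by linarith) h2
  linarith

/-! ### Comparison of `Γ` with its flower graph. -/

theorem energyForm_of_flower [Fintype V] (Γ : MetricGraph V E) (q : E → ℝ → ℝ) (α : V → ℝ)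
    (c : Unit → ℂ) (g : E → ℝ → ℂ) :
    Γ.energyForm q α (fun _ => c ()) g (fun _ => c ()) g =
      Γ.flower.energyForm q (fun _ => ∑ v, α v) c g c g := by
  rw [energyForm, energyForm, Fintype.sum_unique (ι := Unit), ← Finset.sum_mul, Complex.ofReal_sum]
  rfl

end MetricGraph

theorem mainTheorem11 {V E : Type*} [Fintype V] [DecidableEq V] [Fintype E]
    (Γ : MetricGraph V E) (hΓ : Γ.NoIsolatedVertex)
    (q : E → ℝ → ℝ) (hq : ∀ e, MemLp (q e) ⊤ (edgeMeasure (Γ.length e)))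
    (α : V → ℝ) (hα : 0 < ∑ v, α v) :
    IsLeast (Γ.eigenvalues q α) (Γ.lambdaOne q α) ∧
    IsLeast (Γ.flower.eigenvalues q (fun _ => ∑ v, α v))
      (Γ.flower.lambdaOne q (fun _ => ∑ v, α v)) ∧
    Γ.lambdaOne q α ≤ Γ.flower.lambdaOne q (fun _ => ∑ v, α v) ∧
    ((∀ e, q e =ᵐ[edgeMeasure (Γ.length e)] 0) →
      ∃ k, IsLeast (Γ.secularSolutions (∑ v, α v)) k ∧
        Γ.flower.lambdaOne q (fun _ => ∑ v, α v) = k ^ 2 ∧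
        Γ.lambdaOne q α ≤ k ^ 2) := by
  -- An empty sum of strengths would be `0`, so there is a vertex, and positive degree then supplies
  -- an edge.
  have hV : Nonempty V := by
    by_contra h
    rw [not_nonempty_iff] at h
    simp at hα
  have hE : Nonempty E := ⟨(hΓ (Classical.arbitrary V)).choose⟩
  have hflower : Γ.flower.NoIsolatedVertex := fun _ => ⟨Classical.arbitrary E, Or.inl rfl⟩
  obtain ⟨m, hm, hmin⟩ := Γ.exists_mem_eigenvalues_forall_le hΓ hq α
  obtain ⟨μ, hμ, hμmin⟩ :=
    Γ.flower.exists_mem_eigenvalues_forall_le hflower hq (fun _ => ∑ v, α v)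
  have hL := MetricGraph.isLeast_eigenvalues hm hmin
  have hLf := MetricGraph.isLeast_eigenvalues hμ hμmin
  have e1 : Γ.lambdaOne q α = m := hL.csInf_eq
  have e2 : Γ.flower.lambdaOne q (fun _ => ∑ v, α v) = μ := hLf.csInf_eq
  obtain ⟨c, g, hcg, h0, he⟩ := Γ.flower.exists_energyForm_eq_of_mem_eigenvalues hμ
  have hre : (Γ.flower.energyForm q (fun _ => ∑ v, α v) c g c g).re =
      μ * (Γ.flower.massForm c g c g).re := by
    rw [he, Complex.re_ofReal_mul]
  have hle : m ≤ μ := by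
    -- The flower ground state serves as trial function on `Γ`.
    have := hmin _ _ hcg.of_flower
    rw [Γ.energyForm_of_flower, hre] at this
    exact le_of_mul_le_mul_right this h0
  rw [e1, e2]
  refine ⟨hL, hLf, hle, fun hq0 => ?_⟩
  obtain ⟨k, hk, hkℓ, hkL⟩ := Γ.exists_isLeast_secularSolutions hα
  have hk2 : μ = k ^ 2 := by
    -- The cosine eigenfunction gives `μ ≤ k²`; Picone's bound applied to the flower ground state
    -- gives the converse.
    refine le_antisymm (hLf.2 (Γ.sq_mem_eigenvalues_flower hq0 hkL.1)) ?_
    have := Γ.sq_mul_massForm_le_energyForm_flower hq0 hk hkℓ hkL.1 hcg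
    rw [hre] at this
    exact le_of_mul_le_mul_right this h0
  exact ⟨k, hkL, hk2, hk2 ▸ hle⟩
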